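/- Let $A=\{0,1\}$. A right-ideal homomorphism is a partial function $\varphi:A^*\to A^*$ whose domain is a finitely generated right ideal of $A^*$ and which satisfies $\varphi(xz)=\varphi(x)z$ for all $x\in\mathrm{Dom}(\varphi)$, $z\in A^*$. It has a unique maximum essential extension $\max(\varphi)$ (an extension $\psi$ of $\varphi$ is essential if $\mathrm{Dom}(\varphi)$ meets every right ideal that $\mathrm{Dom}(\psi)$ meets). The Thompson–Higman monoid $M_{2,1}$ consists of all maximal right-ideal homomorphisms, with product $\varphi\cdot\psi=\max(\varphi\circ\psi)$. The Thompson group $G_{2,1}$ is its group of invertible elements, $lpG_{2,1}=\{g\in G_{2,1}: |g(x)|=|x| \text{ for all } x\in\mathrm{Dom}(g)\}$, and $lepM_{2,1}$ is the submonoid of $M_{2,1}$ of all elements that are represented by a homomorphism $\varphi: PA^*\to QA^*$ ($P,Q$ finite prefix codes, $P$ maximal, $\mathrm{Im}(\varphi)=QA^*$) such that $|x_1|=|x_2|$ implies $|\varphi(x_1)|=|\varphi(x_2)|$. Let $\tau=\{\tau_{i,j}:1\le i<j\}$ be the set of position transpositions ($\tau_{i,j}$ exchanges the $i$th and $j$th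 letters of a word). Let $\Gamma_G\subset G_{2,1}$, $\Gamma_{lepM}\subset lepM_{2,1}$, $\Gamma_M\subset M_{2,1}$ be finite sets such that $\Gamma_G=\Gamma_G^{-1}$ and such that $\Gamma_G\cup\tau$, $\Gamma_{lepM}\cup\tau$, $\Gamma_M\cup\tau$ generate $G_{2,1}$, $lepM_{2,1}$, $M_{2,1}$, respectively; let $|\cdot|_{lepM_{2,1}}$ and $|\cdot|_{M_{2,1}}$ be the word-lengths over $\Gamma_{lepM}\cup\tau$ and $\Gamma_M\cup\tau$. Let $F=\{g\in G_{2,1}: g(x)=x \text{ for all } x\in 0A^*\}$, and for $g\in G_{2,1}$ let $(g)_0\in G_{2,1}$ be given by $0x\mapsto 0\,g(x)$, $1x\mapsto 1x$. Let $d$ be the path distance in the Schreier graph with vertex set $G_{2,1}/F$ (left cosets) and edges $hF\to\gamma hF$ ($h\in G_{2,1}$, $\gamma\in\Gamma_G\cup\tau$), and let $D(g,g')=d\big((g)_0F,(g')_0F\big)$. For $n\in\mathbb N$ define $$\Delta(n)=\max\{D(\mathbf 1,g): g\in lpG_{2,1},\ |g|_{lepM_{2,1}}\le n\},\qquad \delta(n)=\max\{D(\mathbf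 1,g): g\in lpG_{2,1},\ |g|_{M_{2,1}}\le n\}.$$ **Proposition.** These maxima exist (and are finite), and the functions $\Delta$ and $\delta$ are polynomially related, i.e. there are positive integers $a_0,a_1,a_2,d,e$ such that $\Delta(n)\le a_1\,\delta(a_1n^d)^d$ and $\delta(n)\le a_2\,\Delta(a_2n^e)^e$ for all $n\ge a_0$. More precisely, there are integer constants $c_0,c',c_1,c_2\ge 1$ such that for all $n\in\mathbb N$: $$\Delta(n)\ \le\ c_1\,\delta(c_0n)\ \le\ c_2\,\Delta(c'n^2).$$ If $\Gamma_{lepM}\subseteq\Gamma_M\cup\tau$, then there are integer constants $c',c_1,c_2\ge1$ such that for all $n\in\mathbb N$: $$\Delta(n)\ \le\ c_1\,\delta(n)\ \le\ c_2\,\Delta(c'n^2).$$ -/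

import Mathlib

namespace Thompson

/-- Words over the alphabet `{0,1}`, with `0 = false` and `1 = true`. -/
abbrev Word : Type := List Bool

/-! ## Right ideals and prefix codes of the free monoid of words -/

/-- `R` is a right ideal: `R A* ⊆ R`. -/
def IsRightIdeal (R : Set Word) : Prop :=
  ∀ x ∈ R, ∀ z : Word, x ++ z ∈ R

/-- The right ideal `C A*` generated by `C`. -/
def genIdeal (C : Set Word) : Set Word :=
  {x | ∃ p ∈ C, p <+: x}

/-- A right ideal is essential if it meets every (nonempty) right ideal. -/
def Essential (R : Set Word) : Prop :=
  ∀ I : Set Word, IsRightIdeal I → I.Nonempty → (R ∩ I).Nonempty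

/-- `R'` is essential in `R` if `R'` meets every right ideal that `R` meets. -/
def EssentialIn (R' R : Set Word) : Prop :=
  ∀ I : Set Word, IsRightIdeal I → (R ∩ I).Nonempty → (R' ∩ I).Nonempty

/-- No element of `C` is a prefix of another element of `C`. -/
def IsPrefixCode (C : Set Word) : Prop :=
  ∀ x ∈ C, ∀ y ∈ C, x <+: y → x = y

/-- A prefix code that is not strictly contained in another prefix code. -/
def IsMaximalPrefixCode (C : Set Word) : Prop :=
  IsPrefixCode C ∧ ∀ C' : Set Word, IsPrefixCode C' → C ⊆ C' → C' = C

/-! ## Right-ideal homomorphisms -/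

/-- A right-ideal homomorphism with finitely generated domain, as a partial function on words.
Its image is then also a finitely generated right ideal. -/
@[ext]
structure RIHom where
  toFun : Word → Option Word
  map_append : ∀ x y z : Word, toFun x = some y → toFun (x ++ z) = some (y ++ z)
  fg : ∃ P : Set Word, P.Finite ∧ {x | (toFun x).isSome} = genIdeal P

namespace RIHom

/-- The domain. -/
def dom (f : RIHom) : Set Word := {x | ∃ y, f.toFun x = some y}

/-- The image. -/
def im (f : RIHom) : Set Word := {y | ∃ x, f.toFun x = some y}

theorem isSome_set_eq (f : RIHom) : {x | (f.toFun x).isSome} = f.dom := by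
  ext x; simp [dom, Option.isSome_iff_exists]

theorem dom_rightIdeal (f : RIHom) : IsRightIdeal f.dom := by
  rintro x ⟨y, hy⟩ z
  exact ⟨_, f.map_append _ _ z hy⟩

theorem im_rightIdeal (f : RIHom) : IsRightIdeal f.im := by
  rintro y ⟨x, hy⟩ z
  exact ⟨_, f.map_append _ _ z hy⟩

/-- `g` is an essential restriction of `f` (and `f` is an essential extension of `g`). -/
def EssRestr (g f : RIHom) : Prop :=
  (∀ x y, g.toFun x = some y → f.toFun x = some y) ∧ EssentialIn g.dom f.dom

/-- `f` has no proper essential extension. -/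
def IsMax (f : RIHom) : Prop :=
  ∀ g : RIHom, EssRestr f g → g = f

theorem essRestr_iff (g f : RIHom) : EssRestr g f ↔
    (∀ x y, g.toFun x = some y → f.toFun x = some y) ∧
      ∀ x ∈ f.dom, ∃ v, x ++ v ∈ g.dom := by
  refine and_congr_right fun _ => ⟨fun h x hx => ?_, fun h I hI => ?_⟩
  · obtain ⟨w, hw, v, rfl⟩ := h {w | x <+: w}
      (fun w hw z => hw.trans (List.prefix_append _ _)) ⟨x, hx, List.prefix_refl x⟩
    exact ⟨v, hw⟩
  · rintro ⟨x, hx, hxI⟩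
    obtain ⟨v, hv⟩ := h x hx
    exact ⟨x ++ v, hv, hI x hxI v⟩

theorem essRestr_refl (f : RIHom) : EssRestr f f :=
  ⟨fun _ _ h => h, fun _ _ h => h⟩

theorem EssRestr.trans {f g h : RIHom} (h₁ : EssRestr f g) (h₂ : EssRestr g h) :
    EssRestr f h :=
  ⟨fun x y hx => h₂.1 x y (h₁.1 x y hx), fun I hI hne => h₁.2 I hI (h₂.2 I hI hne)⟩

theorem ext_of_le {f g : RIHom} (h₁ : ∀ x y, f.toFun x = some y → g.toFun x = some y)
    (h₂ : ∀ x y, g.toFun x = some y → f.toFun x = some y) : f = g := by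
  ext x y
  exact ⟨h₁ x y, h₂ x y⟩

/-! ### The maximum essential extension -/

/-- `y` is the value at `x` of the maximum essential extension of `f`: every extension of `x`
can be extended into the domain of `f`, and there `f` acts as `x z ↦ y z`. -/
def MaxVal (f : RIHom) (x y : Word) : Prop :=
  (∀ u, ∃ v, x ++ u ++ v ∈ f.dom) ∧ ∀ z w, f.toFun (x ++ z) = some w → w = y ++ z

theorem MaxVal.unique {f : RIHom} {x y y' : Word} (h : f.MaxVal x y) (h' : f.MaxVal x y') :
    y = y' := by
  obtain ⟨v, w, hw⟩ := h.1 []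
  rw [List.append_nil] at hw
  exact List.append_cancel_right ((h.2 v w hw).symm.trans (h'.2 v w hw))

theorem MaxVal.append {f : RIHom} {x y : Word} (h : f.MaxVal x y) (z : Word) :
    f.MaxVal (x ++ z) (y ++ z) := by
  refine ⟨fun u => ?_, fun z' w hw => ?_⟩
  · obtain ⟨v, hv⟩ := h.1 (z ++ u)
    exact ⟨v, by simpa [List.append_assoc] using hv⟩
  · have := h.2 (z ++ z') w (by simpa [List.append_assoc] using hw)
    simpa [List.append_assoc] using this

theorem maxVal_of_eq {f : RIHom} {x y : Word} (h : f.toFun x = some y) : f.MaxVal x y := by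
  refine ⟨fun u => ⟨[], ?_⟩, fun z w hw => ?_⟩
  · rw [List.append_nil]
    exact ⟨_, f.map_append _ _ u h⟩
  · rw [f.map_append _ _ z h] at hw
    exact (Option.some.inj hw).symm

open Classical in
/-- The underlying partial function of the maximum essential extension. -/
noncomputable def maxFun (f : RIHom) (x : Word) : Option Word :=
  if h : ∃ y, f.MaxVal x y then some h.choose else none

theorem maxFun_eq_some {f : RIHom} {x y : Word} : f.maxFun x = some y ↔ f.MaxVal x y := by
  unfold maxFun
  split_ifs with h
  · constructor
    · intro e
      rw [← Option.some.inj e]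
      exact h.choose_spec
    · intro hy
      rw [h.choose_spec.unique hy]
  · constructor
    · intro e; cases e
    · intro hy; exact absurd ⟨y, hy⟩ h

/-- The maximum essential extension `max(f)`. -/
noncomputable def maxExt (f : RIHom) : RIHom where
  toFun := f.maxFun
  map_append x y z h := maxFun_eq_some.2 ((maxFun_eq_some.1 h).append z)
  fg := by
    obtain ⟨P, hP, hdom⟩ := f.fg
    rw [isSome_set_eq] at hdom
    obtain ⟨L, hL⟩ : ∃ L, ∀ p ∈ P, p.length ≤ L := by
      obtain ⟨L, hL⟩ := (hP.image List.length).bddAbove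
      exact ⟨L, fun p hp => hL ⟨p, hp, rfl⟩⟩
    refine ⟨{x | x.length ≤ L ∧ ∃ y, f.MaxVal x y},
      (List.finite_length_le Bool L).subset fun x hx => hx.1, ?_⟩
    ext x
    constructor
    · intro hx
      obtain ⟨y, hy⟩ := Option.isSome_iff_exists.1 hx
      replace hy := maxFun_eq_some.1 hy
      by_cases hlen : x.length ≤ L
      · exact ⟨x, ⟨hlen, y, hy⟩, List.prefix_refl x⟩
      · obtain ⟨v, hv⟩ := hy.1 []
        rw [List.append_nil, hdom] at hv
        obtain ⟨p, hp, hpx⟩ := hv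
        have hpx' : p <+: x :=
          List.prefix_of_prefix_length_le hpx (List.prefix_append _ _)
            ((hL p hp).trans (not_le.1 hlen).le)
        have hpd : p ∈ f.dom := by rw [hdom]; exact ⟨p, hp, List.prefix_refl p⟩
        obtain ⟨q, hq⟩ := hpd
        exact ⟨p, ⟨hL p hp, q, maxVal_of_eq hq⟩, hpx'⟩
    · rintro ⟨p, ⟨-, y, hy⟩, z, rfl⟩
      exact Option.isSome_iff_exists.2 ⟨_, maxFun_eq_some.2 (hy.append z)⟩

theorem maxExt_eq_some {f : RIHom} {x y : Word} :
    f.maxExt.toFun x = some y ↔ f.MaxVal x y := maxFun_eq_some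

theorem essRestr_maxExt (f : RIHom) : EssRestr f f.maxExt := by
  rw [essRestr_iff]
  refine ⟨fun x y h => maxExt_eq_some.2 (maxVal_of_eq h), ?_⟩
  rintro x ⟨y, hy⟩
  obtain ⟨v, hv⟩ := (maxExt_eq_some.1 hy).1 []
  exact ⟨v, by simpa using hv⟩

/-- `max(f)` extends every essential extension of `f`. -/
theorem EssRestr.le_maxExt {f g : RIHom} (h : EssRestr f g) :
    ∀ x y, g.toFun x = some y → f.maxExt.toFun x = some y := by
  intro x y hxy
  rw [essRestr_iff] at h
  refine maxExt_eq_some.2 ⟨fun u => h.2 _ ⟨_, g.map_append _ _ u hxy⟩, fun z w hw => ?_⟩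
  have h1 := h.1 _ _ hw
  rw [g.map_append _ _ z hxy] at h1
  exact (Option.some.inj h1).symm

theorem EssRestr.maxExt_eq {f g : RIHom} (h : EssRestr f g) : f.maxExt = g.maxExt := by
  have h1 : EssRestr g f.maxExt := by
    refine ⟨h.le_maxExt, fun I hI hne => ?_⟩
    obtain ⟨x, ⟨y, hy⟩, hx⟩ := (essRestr_maxExt f).2 I hI hne
    exact ⟨x, ⟨y, h.1 _ _ hy⟩, hx⟩
  exact ext_of_le h1.le_maxExt (h.trans (essRestr_maxExt g)).le_maxExt

theorem maxExt_isMax (f : RIHom) : f.maxExt.IsMax := by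
  intro g hg
  exact ext_of_le ((essRestr_maxExt f).trans hg).le_maxExt hg.1

theorem IsMax.maxExt_eq {f : RIHom} (h : f.IsMax) : f.maxExt = f :=
  h _ (essRestr_maxExt f)

/-! ### Identity and composition -/

/-- The identity on all words. -/
def id : RIHom where
  toFun := some
  map_append x y z h := by rw [Option.some.inj h]
  fg := ⟨{[]}, Set.finite_singleton _, by ext x; simp [genIdeal]⟩

/-- Composition of partial functions, `(f ∘ g)(x) = f (g x)`. -/
def comp (f g : RIHom) : RIHom where
  toFun x := (g.toFun x).bind f.toFun
  map_append x y z h := by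
    obtain ⟨w, hw, hy⟩ := Option.bind_eq_some_iff.1 h
    exact Option.bind_eq_some_iff.2 ⟨_, g.map_append _ _ z hw, f.map_append _ _ z hy⟩
  fg := by
    obtain ⟨P, hP, hgd⟩ := g.fg
    obtain ⟨Q, hQ, hfd⟩ := f.fg
    rw [isSome_set_eq] at hgd hfd
    refine ⟨{x | x ∈ Set.image2 (fun p q => p ++ q.drop ((g.toFun p).getD []).length) P Q ∧
      ∃ y, (g.toFun x).bind f.toFun = some y}, (hP.image2 _ hQ).subset fun x hx => hx.1, ?_⟩
    ext x
    constructor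
    · intro hx
      obtain ⟨y, hy⟩ := Option.isSome_iff_exists.1 hx
      obtain ⟨w, hw, hy'⟩ := Option.bind_eq_some_iff.1 hy
      have hxg : x ∈ g.dom := ⟨w, hw⟩
      rw [hgd] at hxg
      obtain ⟨p, hp, z, rfl⟩ := hxg
      have hpd : p ∈ g.dom := by rw [hgd]; exact ⟨p, hp, List.prefix_refl p⟩
      obtain ⟨r, hr⟩ := hpd
      rw [g.map_append _ _ z hr] at hw
      obtain rfl := Option.some.inj hw
      have hwf : r ++ z ∈ f.dom := ⟨y, hy'⟩
      rw [hfd] at hwf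
      obtain ⟨q, hq, hqr⟩ := hwf
      have hqd : q ∈ f.dom := by rw [hfd]; exact ⟨q, hq, List.prefix_refl q⟩
      have hkey : q <+: r ++ q.drop r.length ∧ q.drop r.length <+: z := by
        rcases le_total q.length r.length with hle | hle
        · rw [List.drop_eq_nil_of_le hle]
          refine ⟨?_, List.nil_prefix⟩
          rw [List.append_nil]
          exact List.prefix_of_prefix_length_le hqr (List.prefix_append _ _) hle
        · obtain ⟨t, rfl⟩ := List.prefix_of_prefix_length_le (List.prefix_append r z) hqr hle
          rw [List.drop_left]
          exact ⟨List.prefix_refl _, (List.prefix_append_right_inj r).1 hqr⟩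
      refine ⟨p ++ q.drop r.length, ⟨⟨p, hp, q, hq, by simp [hr]⟩, ?_⟩,
        (List.prefix_append_right_inj p).2 hkey.2⟩
      obtain ⟨t, ht⟩ := hkey.1
      obtain ⟨s, hs⟩ := hqd
      refine ⟨s ++ t, ?_⟩
      rw [g.map_append _ _ _ hr, Option.bind_some, ← ht]
      exact f.map_append _ _ t hs
    · rintro ⟨p, ⟨-, y, hy⟩, z, rfl⟩
      obtain ⟨w, hw, hy⟩ := Option.bind_eq_some_iff.1 hy
      refine Option.isSome_iff_exists.2 ⟨_, Option.bind_eq_some_iff.2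
        ⟨_, g.map_append _ _ z hw, f.map_append _ _ z hy⟩⟩

theorem comp_eq_some {f g : RIHom} {x y : Word} :
    (f.comp g).toFun x = some y ↔ ∃ w, g.toFun x = some w ∧ f.toFun w = some y :=
  Option.bind_eq_some_iff

theorem comp_assoc (f g h : RIHom) : (f.comp g).comp h = f.comp (g.comp h) := by
  ext x : 2
  simp [comp, Option.bind_assoc]

theorem id_comp (f : RIHom) : id.comp f = f := by
  ext x : 2
  simp [comp, id]

theorem comp_id (f : RIHom) : f.comp id = f := by
  ext x : 2
  simp [comp, id]

theorem id_isMax : id.IsMax := by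
  intro g hg
  refine ext_of_le (fun x y h => ?_) hg.1
  have h2 := hg.1 x x rfl
  rw [h] at h2
  rw [Option.some.inj h2]
  rfl

theorem EssRestr.comp {f f' g g' : RIHom} (hf : EssRestr f f') (hg : EssRestr g g') :
    EssRestr (f.comp g) (f'.comp g') := by
  rw [essRestr_iff] at hf hg ⊢
  refine ⟨fun x y h => ?_, ?_⟩
  · obtain ⟨w, hw, hy⟩ := comp_eq_some.1 h
    exact comp_eq_some.2 ⟨w, hg.1 _ _ hw, hf.1 _ _ hy⟩
  · rintro x ⟨y, hy⟩
    obtain ⟨w, hw, hy⟩ := comp_eq_some.1 hy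
    obtain ⟨v, r, hv⟩ := hg.2 x ⟨w, hw⟩
    have e := hg.1 _ _ hv
    rw [g'.map_append _ _ v hw] at e
    obtain rfl := Option.some.inj e
    obtain ⟨t, s, ht⟩ := hf.2 (w ++ v) ⟨_, f'.map_append _ _ v hy⟩
    refine ⟨v ++ t, s, comp_eq_some.2 ⟨w ++ v ++ t, ?_, ht⟩⟩
    rw [← List.append_assoc]
    exact g.map_append _ _ t hv

end RIHom

/-! ## The Thompson-Higman monoid `M_{2,1}` -/

/-- The elements of `M_{2,1}`: maximal right-ideal homomorphisms. -/
def M21 : Type := {f : RIHom // f.IsMax}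

namespace M21

/-- The partial action on words. -/
def act (a : M21) (x : Word) : Option Word := a.1.toFun x

/-- The element of `M_{2,1}` represented by a right-ideal homomorphism. -/
noncomputable def ofHom (f : RIHom) : M21 := ⟨f.maxExt, f.maxExt_isMax⟩

theorem ofHom_eq_of_essRestr {f g : RIHom} (h : f.EssRestr g) : ofHom f = ofHom g :=
  Subtype.ext h.maxExt_eq

theorem ofHom_val (a : M21) : ofHom a.1 = a := Subtype.ext a.2.maxExt_eq

/-- Multiplication is composition followed by maximum essential extension. -/
noncomputable instance : Monoid M21 where
  one := ⟨RIHom.id, RIHom.id_isMax⟩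
  mul a b := ofHom (a.1.comp b.1)
  mul_assoc a b c := by
    have h1 : ofHom ((ofHom (a.1.comp b.1)).1.comp c.1) = ofHom ((a.1.comp b.1).comp c.1) :=
      (ofHom_eq_of_essRestr ((a.1.comp b.1).essRestr_maxExt.comp c.1.essRestr_refl)).symm
    have h2 : ofHom (a.1.comp (ofHom (b.1.comp c.1)).1) = ofHom (a.1.comp (b.1.comp c.1)) :=
      (ofHom_eq_of_essRestr (a.1.essRestr_refl.comp (b.1.comp c.1).essRestr_maxExt)).symm
    exact h1.trans ((congrArg ofHom (RIHom.comp_assoc _ _ _)).trans h2.symm)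
  one_mul a := (congrArg ofHom (RIHom.id_comp a.1)).trans (ofHom_val a)
  mul_one a := (congrArg ofHom (RIHom.comp_id a.1)).trans (ofHom_val a)

theorem one_val : (1 : M21).1 = RIHom.id := rfl

theorem mul_def (a b : M21) : a * b = ofHom (a.1.comp b.1) := rfl

theorem ofHom_mul (f g : RIHom) : ofHom f * ofHom g = ofHom (f.comp g) :=
  (ofHom_eq_of_essRestr (f.essRestr_maxExt.comp g.essRestr_maxExt)).symm

end M21

/-- The submonoid `lepM_{2,1}` (as a set): the elements of `M_{2,1}` represented by a
length-equality preserving right-ideal homomorphism `P A* → Q A*`, where `P`, `Q` are finite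
prefix codes and `P` is maximal. -/
def lepM21 : Set M21 :=
  {a | ∃ (f : RIHom) (P Q : Set Word), P.Finite ∧ Q.Finite ∧
    IsMaximalPrefixCode P ∧ IsPrefixCode Q ∧ f.dom = genIdeal P ∧ f.im = genIdeal Q ∧
    (∀ x₁ x₂ y₁ y₂ : Word, f.toFun x₁ = some y₁ → f.toFun x₂ = some y₂ →
      x₁.length = x₂.length → y₁.length = y₂.length) ∧
    M21.ofHom f = a}

/-! ## The Thompson group `G_{2,1}` -/

/-- The Thompson group `G_{2,1}`, as the group of invertible elements of `M_{2,1}`; these are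
exactly the maximally extended isomorphisms between finitely generated essential right ideals,
see `isUnit_iff`. -/
abbrev G21 : Type := M21ˣ

theorem act_mul_of_act {a b : M21} {x y z : Word} (hb : b.act x = some y)
    (ha : a.act y = some z) : (a * b).act x = some z :=
  (RIHom.essRestr_maxExt (a.1.comp b.1)).1 _ _ (RIHom.comp_eq_some.2 ⟨y, hb, ha⟩)

/-- The inverse partial function of an injective right-ideal homomorphism. -/
theorem exists_inverse (f : RIHom)
    (hinj : ∀ x x' y, f.toFun x = some y → f.toFun x' = some y → x = x') :
    ∃ g : RIHom, ∀ x y, g.toFun y = some x ↔ f.toFun x = some y := by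
  classical
  have key : ∀ x y, (if h : ∃ x, f.toFun x = some y then some h.choose else none) = some x ↔
      f.toFun x = some y := by
    intro x y
    split_ifs with h
    · constructor
      · intro e
        rw [← Option.some.inj e]
        exact h.choose_spec
      · intro e
        rw [hinj _ _ _ h.choose_spec e]
    · constructor
      · intro e; cases e
      · intro e; exact absurd ⟨x, e⟩ h
  obtain ⟨P, hP, hdom⟩ := f.fg
  rw [RIHom.isSome_set_eq] at hdom
  refine ⟨⟨fun y => if h : ∃ x, f.toFun x = some y then some h.choose else none, ?_, ?_⟩, key⟩
  · intro y x z h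
    exact (key _ _).2 (f.map_append _ _ z ((key _ _).1 h))
  · refine ⟨(fun p => (f.toFun p).getD []) '' P, hP.image _, ?_⟩
    ext y
    constructor
    · intro hy
      obtain ⟨x, hx⟩ := Option.isSome_iff_exists.1 hy
      replace hx := (key _ _).1 hx
      have hxd : x ∈ f.dom := ⟨y, hx⟩
      rw [hdom] at hxd
      obtain ⟨p, hp, z, rfl⟩ := hxd
      have hpd : p ∈ f.dom := by rw [hdom]; exact ⟨p, hp, List.prefix_refl p⟩
      obtain ⟨q, hq⟩ := hpd
      rw [f.map_append _ _ z hq] at hx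
      refine ⟨q, ⟨p, hp, by simp [hq]⟩, z, Option.some.inj hx⟩
    · rintro ⟨q, ⟨p, hp, rfl⟩, z, rfl⟩
      have hpd : p ∈ f.dom := by rw [hdom]; exact ⟨p, hp, List.prefix_refl p⟩
      obtain ⟨q, hq⟩ := hpd
      refine Option.isSome_iff_exists.2 ⟨p ++ z, (key _ _).2 ?_⟩
      change f.toFun (p ++ z) = some ((f.toFun p).getD [] ++ z)
      rw [hq]
      exact f.map_append _ _ z hq

theorem exists_append_of_mul_eq_one {a b : M21} (h : a * b = 1) (x : Word) :
    ∃ v y, b.act (x ++ v) = some y ∧ a.act y = some (x ++ v) := by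
  have hr := RIHom.essRestr_maxExt (a.1.comp b.1)
  have h' : (a.1.comp b.1).maxExt = RIHom.id := congrArg Subtype.val h
  rw [h', RIHom.essRestr_iff] at hr
  obtain ⟨v, z, hv⟩ := hr.2 x ⟨x, rfl⟩
  have e : x ++ v = z := Option.some.inj (hr.1 _ _ hv)
  subst e
  obtain ⟨y, hy, hz⟩ := RIHom.comp_eq_some.1 hv
  exact ⟨v, y, hy, hz⟩

/-- The invertible elements of `M_{2,1}` are the maximal isomorphisms between essential right
ideals. -/
theorem isUnit_iff (a : M21) : IsUnit a ↔
    (∀ x x' y, a.act x = some y → a.act x' = some y → x = x') ∧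
      Essential a.1.dom ∧ Essential a.1.im := by
  constructor
  · rintro ⟨u, rfl⟩
    refine ⟨fun x x' y h h' => ?_, fun I hI hne => ?_, fun I hI hne => ?_⟩
    · obtain ⟨v, t, hv, ht⟩ := exists_append_of_mul_eq_one (u.inv_mul) x
      obtain ⟨v', t', hv', ht'⟩ := exists_append_of_mul_eq_one (u.inv_mul) (x' ++ v)
      have e1 := (u : M21).1.map_append _ _ v h
      have e1' := (u : M21).1.map_append _ _ (v ++ v') h'
      have e2 : t = y ++ v := Option.some.inj (hv.symm.trans e1)
      rw [List.append_assoc] at hv'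
      have e2' : t' = y ++ (v ++ v') := Option.some.inj (hv'.symm.trans e1')
      subst e2 e2'
      have e3 := (↑u⁻¹ : M21).1.map_append _ _ v' ht
      rw [List.append_assoc] at e3
      have e4 := Option.some.inj (e3.symm.trans ht')
      exact List.append_cancel_right (List.append_cancel_right e4)
    · obtain ⟨x, hx⟩ := hne
      obtain ⟨v, y, hv, -⟩ := exists_append_of_mul_eq_one (u.inv_mul) x
      exact ⟨x ++ v, ⟨y, hv⟩, hI x hx v⟩
    · obtain ⟨x, hx⟩ := hne
      obtain ⟨v, y, -, hv⟩ := exists_append_of_mul_eq_one (u.mul_inv) x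
      exact ⟨x ++ v, ⟨y, hv⟩, hI x hx v⟩
  · rintro ⟨hinj, hd, hi⟩
    obtain ⟨g, hg⟩ := exists_inverse a.1 hinj
    have ess : ∀ {R : Set Word}, Essential R → ∀ x, ∃ v, x ++ v ∈ R := by
      intro R hR x
      obtain ⟨w, hw, v, rfl⟩ := hR {w | x <+: w}
        (fun w hw z => List.IsPrefix.trans hw (List.prefix_append _ _)) ⟨x, List.prefix_refl x⟩
      exact ⟨v, hw⟩
    have hone : ∀ f : RIHom, f.EssRestr RIHom.id → M21.ofHom f = 1 := fun f hf =>
      (M21.ofHom_eq_of_essRestr hf).trans (M21.ofHom_val 1)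
    refine ⟨⟨a, M21.ofHom g, ?_, ?_⟩, rfl⟩
    · rw [← M21.ofHom_val a, M21.ofHom_mul]
      refine hone _ ((RIHom.essRestr_iff _ _).2 ⟨fun x y h => ?_, fun x _ => ?_⟩)
      · obtain ⟨w, hw, hy⟩ := RIHom.comp_eq_some.1 h
        exact ((hg _ _).1 hw).symm.trans hy
      · obtain ⟨v, w, hv⟩ := ess hi x
        exact ⟨v, x ++ v, RIHom.comp_eq_some.2 ⟨w, (hg _ _).2 hv, hv⟩⟩
    · rw [← M21.ofHom_val a, M21.ofHom_mul]
      refine hone _ ((RIHom.essRestr_iff _ _).2 ⟨fun x y h => ?_, fun x _ => ?_⟩)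
      · obtain ⟨w, hw, hy⟩ := RIHom.comp_eq_some.1 h
        rw [show RIHom.id.toFun x = some x from rfl, hinj _ _ _ hw ((hg _ _).1 hy)]
      · obtain ⟨v, w, hv⟩ := ess hd x
        exact ⟨v, x ++ v, RIHom.comp_eq_some.2 ⟨w, hv, (hg _ _).2 hv⟩⟩

/-- The subgroup `lpG_{2,1}` of length-preserving elements of `G_{2,1}` (as a set). -/
def lpG21 : Set G21 :=
  {g | ∀ x y, (g : M21).act x = some y → y.length = x.length}

/-! ## Position transpositions -/

/-- Exchange the letters at the positions `i < j` (counted from `0`) of a word. -/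
def swapWord (i j : ℕ) (x : Word) : Word :=
  (x.set i (x.getD j false)).set j (x.getD i false)

/-- The position transposition, defined on the words long enough to have a letter at `j`. -/
def tauHom (i j : ℕ) (hij : i < j) : RIHom where
  toFun x := if j < x.length then some (swapWord i j x) else none
  map_append x y z h := by
    split_ifs at h with hj
    rw [← Option.some.inj h, if_pos (by rw [List.length_append]; omega)]
    have hi : i < x.length := hij.trans hj
    simp only [swapWord]
    rw [List.getD_append _ _ _ _ hj, List.getD_append _ _ _ _ hi, List.set_append_left _ _ hi,
      List.set_append_left _ _ (by simpa using hj)]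
  fg := by
    refine ⟨{p | p.length = j + 1}, List.finite_length_eq Bool (j + 1), ?_⟩
    ext x
    constructor
    · intro hx
      have hj : j < x.length := by
        by_contra hj
        simp [hj] at hx
      exact ⟨x.take (j + 1), by simp only [Set.mem_ofPred_eq, List.length_take]; omega,
        List.take_prefix _ _⟩
    · rintro ⟨p, hp, hpx⟩
      have := hpx.length_le
      simp only [Set.mem_ofPred_eq] at hp ⊢
      rw [if_pos (by omega)]
      rfl

/-- The set `τ` of all position transpositions in `M_{2,1}`. -/
def tauM : Set M21 := {a | ∃ (i j : ℕ) (hij : i < j), a = M21.ofHom (tauHom i j hij)}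

theorem swapWord_swapWord {i j : ℕ} (hij : i < j) {x : Word} (hj : j < x.length) :
    swapWord i j (swapWord i j x) = x := by
  have hi : i < x.length := hij.trans hj
  apply List.ext_getElem
  · simp [swapWord]
  · intro k h1 h2
    simp only [swapWord, List.getElem_set, List.getD_eq_getElem?_getD, List.getElem?_set,
      List.length_set]
    grind

theorem tau_mul_self (i j : ℕ) (hij : i < j) :
    M21.ofHom (tauHom i j hij) * M21.ofHom (tauHom i j hij) = 1 := by
  rw [M21.ofHom_mul]
  refine (M21.ofHom_eq_of_essRestr (g := RIHom.id) ?_).trans (M21.ofHom_val 1)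
  have hlen : ∀ x : Word, (swapWord i j x).length = x.length := fun x => by simp [swapWord]
  rw [RIHom.essRestr_iff]
  refine ⟨fun x y h => ?_, fun x _ => ⟨List.replicate (j + 1) false,
    x ++ List.replicate (j + 1) false, ?_⟩⟩
  · obtain ⟨w, hw, hy⟩ := RIHom.comp_eq_some.1 h
    simp only [tauHom, Option.ite_none_right_eq_some, Option.some.injEq] at hw hy
    obtain ⟨hj, rfl⟩ := hw
    obtain ⟨-, rfl⟩ := hy
    rw [swapWord_swapWord hij hj]
    rfl
  · have hj : j < (x ++ List.replicate (j + 1) false).length := by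
      rw [List.length_append, List.length_replicate]; omega
    refine RIHom.comp_eq_some.2 ⟨swapWord i j (x ++ List.replicate (j + 1) false), ?_, ?_⟩
    · exact if_pos hj
    · refine (if_pos (by rwa [hlen])).trans ?_
      rw [swapWord_swapWord hij hj]

/-- The set `τ` of all position transpositions in `G_{2,1}` (each of them is invertible, by
`tau_mul_self`). -/
def tauG : Set G21 := {g | (g : M21) ∈ tauM}

/-! ## The embedding `g ↦ (g)_0` and the fixator of `0 A*` -/

/-- `0 x ↦ 0 f(x)` and `1 x ↦ 1 x`. -/
def lift0Hom (f : RIHom) : RIHom where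
  toFun
    | [] => none
    | false :: x => (f.toFun x).map (List.cons false)
    | true :: x => some (true :: x)
  map_append x y z h := by
    match x, h with
    | false :: x, h =>
      obtain ⟨w, hw, rfl⟩ := Option.map_eq_some_iff.1 h
      exact Option.map_eq_some_iff.2 ⟨_, f.map_append _ _ z hw, rfl⟩
    | true :: x, h =>
      obtain rfl := Option.some.inj h
      rfl
  fg := by
    obtain ⟨P, hP, hdom⟩ := f.fg
    refine ⟨insert [true] (List.cons false '' P), (hP.image _).insert _, ?_⟩
    ext x
    match x with
    | [] => simp [genIdeal]
    | true :: x => simp [genIdeal]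
    | false :: x =>
      have := congrArg (x ∈ ·) hdom
      simpa [genIdeal] using this

theorem lift0Hom_false (f : RIHom) (x : Word) :
    (lift0Hom f).toFun (false :: x) = (f.toFun x).map (List.cons false) := rfl

theorem lift0Hom_true (f : RIHom) (x : Word) :
    (lift0Hom f).toFun (true :: x) = some (true :: x) := rfl

theorem lift0Hom_essRestr {f g : RIHom} (h : f.EssRestr g) :
    (lift0Hom f).EssRestr (lift0Hom g) := by
  rw [RIHom.essRestr_iff] at h ⊢
  refine ⟨fun x y hxy => ?_, fun x hx => ?_⟩
  · match x, hxy with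
    | false :: x, hxy =>
      obtain ⟨w, hw, rfl⟩ := Option.map_eq_some_iff.1 hxy
      exact Option.map_eq_some_iff.2 ⟨_, h.1 _ _ hw, rfl⟩
    | true :: x, hxy => exact hxy
  · match x, hx with
    | false :: x, hx =>
      obtain ⟨y, hy⟩ := hx
      obtain ⟨w, hw, rfl⟩ := Option.map_eq_some_iff.1 hy
      obtain ⟨v, r, hr⟩ := h.2 x ⟨w, hw⟩
      exact ⟨v, false :: r, Option.map_eq_some_iff.2 ⟨_, hr, rfl⟩⟩
    | true :: x, _ => exact ⟨[], true :: x, by rw [List.append_nil]; rfl⟩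

theorem lift0Hom_comp (f g : RIHom) :
    lift0Hom (f.comp g) = (lift0Hom f).comp (lift0Hom g) := by
  ext x : 2
  match x with
  | [] => rfl
  | true :: x => rfl
  | false :: x =>
    change ((g.toFun x).bind f.toFun).map _ = ((g.toFun x).map _).bind _
    cases g.toFun x <;> rfl

/-- `φ ↦ (φ)_0` on `M_{2,1}`. -/
noncomputable def lift0M : M21 →* M21 where
  toFun a := M21.ofHom (lift0Hom a.1)
  map_one' := by
    refine (M21.ofHom_eq_of_essRestr (g := RIHom.id) ?_).trans (M21.ofHom_val 1)
    rw [RIHom.essRestr_iff]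
    refine ⟨fun x y hxy => ?_, fun x _ => ?_⟩
    · match x, hxy with
      | false :: x, hxy => exact hxy
      | true :: x, hxy => exact hxy
    · exact ⟨[true], match x with
        | [] => ⟨_, rfl⟩
        | false :: x => ⟨_, rfl⟩
        | true :: x => ⟨_, rfl⟩⟩
  map_mul' a b := by
    rw [M21.ofHom_mul, ← lift0Hom_comp]
    exact (M21.ofHom_eq_of_essRestr (lift0Hom_essRestr (a.1.comp b.1).essRestr_maxExt)).symm

/-- The embedding `g ↦ (g)_0` of `G_{2,1}` into itself. -/
noncomputable def lift0 : G21 →* G21 := Units.map lift0M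

theorem act_inv_of_act {g : G21} {x : Word} (h : (g : M21).act x = some x) :
    (↑g⁻¹ : M21).act x = some x := by
  have hm := (↑g⁻¹ : M21).2.maxExt_eq
  change (↑g⁻¹ : M21).1.toFun x = some x
  rw [← hm]
  refine RIHom.maxExt_eq_some.2 ⟨fun u => ?_, fun z w hw => ?_⟩
  · obtain ⟨v, y, hv, hy⟩ := exists_append_of_mul_eq_one g.inv_mul (x ++ u)
    refine ⟨v, x ++ u ++ v, ?_⟩
    have e := (g : M21).1.map_append _ _ (u ++ v) h
    rw [← List.append_assoc] at e
    have e2 : y = x ++ u ++ v := Option.some.inj (hv.symm.trans e)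
    rwa [e2] at hy
  · have h1 : ((↑g⁻¹ : M21) * g).act (x ++ z) = some w :=
      act_mul_of_act ((g : M21).1.map_append _ _ z h) hw
    rw [g.inv_mul] at h1
    exact (Option.some.inj h1).symm

/-- The fixator `Fix(0)` of `0 A*` in `G_{2,1}`. -/
def fix0 : Subgroup G21 where
  carrier := {g | ∀ x : Word, (g : M21).act (false :: x) = some (false :: x)}
  one_mem' _ := rfl
  mul_mem' ha hb x := act_mul_of_act (hb x) (ha x)
  inv_mem' ha x := act_inv_of_act (ha x)

/-! ## Word-length, Schreier graph distance, distortion -/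

/-- The word-length of `x` over the set `S`: the minimum length of a word over `S` that
represents `x` (`⊤` if there is none). -/
noncomputable def wordLength {M : Type*} [Monoid M] (S : Set M) (x : M) : ℕ∞ :=
  ⨅ (w : List M) (_ : (∀ s ∈ w, s ∈ S) ∧ w.prod = x), (w.length : ℕ∞)

/-- The directed distance in a directed graph: the minimum length of a directed path from
`u` to `v` (`⊤` if there is none). -/
noncomputable def pathDist {V : Type*} (E : V → V → Prop) (u v : V) : ℕ∞ :=
  ⨅ (n : ℕ) (_ : ∃ p : ℕ → V, p 0 = u ∧ p n = v ∧ ∀ i < n, E (p i) (p (i + 1))), (n : ℕ∞)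

/-- The edges `h F → γ h F`, `γ ∈ S`, of the Schreier left coset graph of `F` in `H`. -/
def schreierEdge {H : Type*} [Group H] (F : Subgroup H) (S : Set H) (u v : H ⧸ F) : Prop :=
  ∃ γ ∈ S, ∃ h : H, u = QuotientGroup.mk h ∧ v = QuotientGroup.mk (γ * h)

/-- The distance on `G_{2,1}` inherited, along `g ↦ (g)_0 Fix(0)`, from the Schreier graph of
`G_{2,1} / Fix(0)` over `S`. -/
noncomputable def schreierDist (S : Set G21) (g g' : G21) : ℕ∞ :=
  pathDist (schreierEdge fix0 S) (lift0 g : G21 ⧸ fix0) (lift0 g' : G21 ⧸ fix0)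

/-- The distortion of `lpG_{2,1}` that compares the Schreier graph distance from `1` over `S`
with the word-length over `T ⊆ M_{2,1}`:
`n ↦ max {D(1,g) : g ∈ lpG_{2,1}, |g|_T ≤ n}`. -/
noncomputable def distortion (S : Set G21) (T : Set M21) (n : ℕ) : ℕ∞ :=
  ⨆ (g : G21) (_ : g ∈ lpG21 ∧ wordLength T (g : M21) ≤ n), schreierDist S 1 g

/-- Polynomial equivalence of two functions. -/
def PolyEquiv (f₁ f₂ : ℕ → ℕ∞) : Prop :=
  ∃ c₀ c₁ c₂ d e : ℕ, 0 < c₀ ∧ 0 < c₁ ∧ 0 < c₂ ∧ 0 < d ∧ 0 < e ∧ ∀ n ≥ c₀,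
    f₁ n ≤ c₁ * f₂ (c₁ * n ^ d) ^ d ∧ f₂ n ≤ c₂ * f₁ (c₂ * n ^ e) ^ e

end Thompson

namespace Thompson

/-! Both inequalities compare word-lengths of elements of `lpG21`; the Schreier distance matters
only for finiteness. A generator in `ΓL` is a fixed word over `ΓM ∪ τ`, so passing from lepM to M
costs a linear factor, or none if `ΓL ⊆ ΓM ∪ τ`.

The converse is `exists_hasLen_quadratic`, a simulation. A generator of M may change the length by
an amount that depends on the input, whereas an element of lepM changes the length of all long words
by one constant. So zeros are pushed in front of the input, and the current sequence starts at a
moving pointer `a` behind them. The pointer is stored as a single set flag among `L` flags. A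
generator of M is simulated by running, for each possible pointer value, a gate that fires only if
its flag is set. A gate rewrites boundedly many positions in a length-preserving way, so by
`exists_gate` it has bounded cost over lepM and τ wherever it acts. For a word of length `n` the
pointer drifts by O(n), so `L` = O(n) suffices and the cost is O(n²). A length-preserving element
brings the pointer back to its start, and the padding can be popped.

Finiteness is not automatic because τ is infinite. By `exists_supportedOn`, an element of `lpG21` of
length `n` over `ΓL ∪ τ` alters only O(n) positions, depending on those positions alone. Conjugation
by O(n) transpositions moves them into a fixed initial segment, where only finitely many elements
live. A transposition has coset length at most 1, so the distances are bounded
(`exists_cosetLen_bound`).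

Elements of M are handled through their partial action on infinite sequences together with the
change of length `d`. This action ignores essential extensions, and it determines the element. -/

/-! ## The action on infinite sequences -/

/-- The infinite sequence that starts with the word `x` and continues with `r`. -/
def pre (x : Word) (r : ℕ → Bool) : ℕ → Bool := fun i => (x[i]?).getD (r (i - x.length))

/-- The prefix of length `k` of an infinite sequence. -/
def initWord (k : ℕ) (s : ℕ → Bool) : Word := (List.range k).map s

@[simp] theorem length_initWord (k : ℕ) (s : ℕ → Bool) : (initWord k s).length = k := by
  simp [initWord]

@[simp] theorem pre_nil (r : ℕ → Bool) : pre [] r = r := by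
  funext i; simp [pre]

theorem pre_of_lt {x : Word} {r : ℕ → Bool} {i : ℕ} (h : i < x.length) : pre x r i = x[i] := by
  simp [pre, h]

theorem pre_add (x : Word) (r : ℕ → Bool) (i : ℕ) : pre x r (x.length + i) = r i := by
  simp [pre]

theorem pre_of_le {x : Word} {r : ℕ → Bool} {i : ℕ} (h : x.length ≤ i) :
    pre x r i = r (i - x.length) := by
  simp [pre, h]

theorem pre_append (x y : Word) (r : ℕ → Bool) : pre (x ++ y) r = pre x (pre y r) := by
  funext i
  rcases lt_or_ge i x.length with h | h
  · rw [pre_of_lt h, pre_of_lt (by simp; omega), List.getElem_append_left h]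
  · rw [pre_of_le h, pre, pre, List.getElem?_append_right h]
    simp [Nat.sub_sub]

theorem pre_initWord (k : ℕ) (s : ℕ → Bool) : pre (initWord k s) (fun i => s (k + i)) = s := by
  funext i
  rcases lt_or_ge i k with h | h
  · rw [pre_of_lt (by simpa using h)]
    simp [initWord]
  · rw [pre_of_le (by simpa using h)]
    simp [h]

theorem pre_inj {x y : Word} {r r' : ℕ → Bool} (h : pre x r = pre y r')
    (hl : x.length = y.length) : x = y ∧ r = r' := by
  constructor
  · refine List.ext_getElem hl fun i h1 h2 => ?_
    have := congrFun h i
    rwa [pre_of_lt h1, pre_of_lt h2] at this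
  · funext i
    have := congrFun h (x.length + i)
    rwa [pre_add, hl, pre_add] at this

theorem pre_split {x y : Word} {r r' : ℕ → Bool} (h : pre x r = pre y r')
    (hl : x.length ≤ y.length) : ∃ v, y = x ++ v ∧ r = pre v r' := by
  have hy : y.take x.length ++ y.drop x.length = y := List.take_append_drop _ _
  rw [← hy, pre_append] at h
  obtain ⟨h1, h2⟩ := pre_inj h (by simp [hl])
  exact ⟨y.drop x.length, hy.symm.trans (congrArg (· ++ _) h1.symm), h2⟩

/-- The right-ideal homomorphism `f` maps the infinite sequence `s` to `t`, replacing a prefix of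
`s` by a prefix of `t` that is longer by `d`. -/
def RIHom.Maps (f : RIHom) (s : ℕ → Bool) (d : ℤ) (t : ℕ → Bool) : Prop :=
  ∃ x y r, f.toFun x = some y ∧ s = pre x r ∧ t = pre y r ∧ (y.length : ℤ) = x.length + d

namespace RIHom

theorem Maps.exists_long {f : RIHom} {s t : ℕ → Bool} {d : ℤ} (h : f.Maps s d t) (m : ℕ) :
    ∃ x y r, m ≤ x.length ∧ f.toFun x = some y ∧ s = pre x r ∧ t = pre y r ∧
      (y.length : ℤ) = x.length + d := by
  obtain ⟨x, y, r, hxy, rfl, rfl, hd⟩ := h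
  refine ⟨x ++ initWord m r, y ++ initWord m r, fun i => r (m + i), by simp,
    f.map_append _ _ _ hxy, ?_, ?_, by simp; omega⟩
  · rw [pre_append, pre_initWord]
  · rw [pre_append, pre_initWord]

theorem maps_of_eq {f : RIHom} {x y : Word} (h : f.toFun x = some y) (r : ℕ → Bool) :
    f.Maps (pre x r) ((y.length : ℤ) - x.length) (pre y r) :=
  ⟨x, y, r, h, rfl, rfl, by ring⟩

theorem Maps.unique {f : RIHom} {s t t' : ℕ → Bool} {d d' : ℤ} (h : f.Maps s d t)
    (h' : f.Maps s d' t') : d = d' ∧ t = t' := by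
  obtain ⟨x, y, r, hxy, rfl, rfl, hd⟩ := h
  obtain ⟨x', y', r', hl, hxy', he, rfl, hd'⟩ := h'.exists_long x.length
  obtain ⟨v, rfl, rfl⟩ := pre_split he hl
  rw [f.map_append _ _ v hxy] at hxy'
  obtain rfl := Option.some.inj hxy'
  refine ⟨?_, (pre_append _ _ _).symm⟩
  simp only [List.length_append, Nat.cast_add] at hd'
  omega

theorem comp_maps {f g : RIHom} {s t : ℕ → Bool} {d : ℤ} : (f.comp g).Maps s d t ↔
    ∃ d₁ u d₂, g.Maps s d₁ u ∧ f.Maps u d₂ t ∧ d = d₁ + d₂ := by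
  constructor
  · rintro ⟨x, y, r, hxy, rfl, rfl, hd⟩
    obtain ⟨w, hw, hy⟩ := comp_eq_some.1 hxy
    exact ⟨_, _, _, maps_of_eq hw r, maps_of_eq hy r, by omega⟩
  · rintro ⟨d₁, u, d₂, ⟨x, y, r, hxy, rfl, rfl, hd⟩, h, rfl⟩
    obtain ⟨x', y', r', hl, hxy', he, rfl, hd'⟩ := h.exists_long y.length
    obtain ⟨v, rfl, rfl⟩ := pre_split he hl
    refine ⟨x ++ v, y', r', comp_eq_some.2 ⟨_, g.map_append _ _ v hxy, hxy'⟩,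
      (pre_append _ _ _).symm, rfl, ?_⟩
    simp only [List.length_append, Nat.cast_add] at hd' ⊢
    omega

/-- The domain of `f` is finitely generated, so a long enough word with an extension in the domain
already lies in it. Hence `max` enlarges the domain only by short words, which infinite sequences
cannot detect. -/
theorem maxExt_maps {f : RIHom} {s t : ℕ → Bool} {d : ℤ} :
    f.maxExt.Maps s d t ↔ f.Maps s d t := by
  constructor
  · intro h
    obtain ⟨P, hP, hdom⟩ := f.fg
    rw [isSome_set_eq] at hdom
    obtain ⟨m, hm⟩ := (hP.image List.length).bddAbove
    obtain ⟨x, y, r, hl, hxy, rfl, rfl, hd⟩ := h.exists_long m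
    rw [maxExt_eq_some] at hxy
    obtain ⟨v, hv⟩ := hxy.1 []
    rw [List.append_nil, hdom] at hv
    obtain ⟨p, hp, hpx⟩ := hv
    have hpx' : p <+: x :=
      List.prefix_of_prefix_length_le hpx (List.prefix_append _ _) ((hm ⟨p, hp, rfl⟩).trans hl)
    obtain ⟨w, hw⟩ : x ∈ f.dom := by rw [hdom]; exact ⟨p, hp, hpx'⟩
    have e := hxy.2 [] w (by simpa using hw)
    rw [List.append_nil] at e
    exact ⟨x, y, r, e ▸ hw, rfl, rfl, hd⟩
  · rintro ⟨x, y, r, hxy, h⟩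
    exact ⟨x, y, r, maxExt_eq_some.2 (maxVal_of_eq hxy), h⟩

end RIHom

namespace M21

/-- The action of `M_{2,1}` on infinite sequences. -/
def Maps (a : M21) (s : ℕ → Bool) (d : ℤ) (t : ℕ → Bool) : Prop := a.1.Maps s d t

theorem ofHom_maps {f : RIHom} {s t : ℕ → Bool} {d : ℤ} :
    (ofHom f).Maps s d t ↔ f.Maps s d t := RIHom.maxExt_maps

theorem mul_maps {a b : M21} {s t : ℕ → Bool} {d : ℤ} : (a * b).Maps s d t ↔
    ∃ d₁ u d₂, b.Maps s d₁ u ∧ a.Maps u d₂ t ∧ d = d₁ + d₂ := by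
  rw [mul_def, ofHom_maps, RIHom.comp_maps]; rfl

theorem Maps.mul {a b : M21} {s t u : ℕ → Bool} {d₁ d₂ : ℤ} (ha : a.Maps u d₂ t)
    (hb : b.Maps s d₁ u) : (a * b).Maps s (d₁ + d₂) t :=
  mul_maps.2 ⟨d₁, u, d₂, hb, ha, rfl⟩

theorem Maps.mul_zero {a b : M21} {s t u : ℕ → Bool} (ha : a.Maps u 0 t)
    (hb : b.Maps s 0 u) : (a * b).Maps s 0 t := by
  simpa using ha.mul hb

theorem Maps.unique {a : M21} {s t t' : ℕ → Bool} {d d' : ℤ} (h : a.Maps s d t)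
    (h' : a.Maps s d' t') : d = d' ∧ t = t' := RIHom.Maps.unique h h'

theorem one_maps (s : ℕ → Bool) : (1 : M21).Maps s 0 s :=
  ⟨[], [], s, rfl, by simp, by simp, by simp⟩

theorem maps_of_act {a : M21} {x y : Word} (h : a.act x = some y) (r : ℕ → Bool) :
    a.Maps (pre x r) ((y.length : ℤ) - x.length) (pre y r) := RIHom.maps_of_eq h r

/-- This is where maximality enters: the action on sequences recovers the values on words, so it is
faithful on M. -/
theorem act_of_maps {a : M21} {x y : Word}
    (h : ∀ r, a.Maps (pre x r) ((y.length : ℤ) - x.length) (pre y r)) : a.act x = some y := by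
  change a.1.toFun x = some y
  rw [← a.2.maxExt_eq, RIHom.maxExt_eq_some]
  refine ⟨fun u => ?_, fun z w hw => ?_⟩
  · obtain ⟨x', y', r, hl, hxy, he, -, -⟩ :=
      (h (pre u fun _ => false)).exists_long (x ++ u).length
    rw [← pre_append] at he
    obtain ⟨v, rfl, -⟩ := pre_split he hl
    exact ⟨v, _, hxy⟩
  · have h1 := h (pre z fun _ => false)
    have h2 := RIHom.maps_of_eq hw fun _ => false
    rw [pre_append] at h2
    obtain ⟨e1, e2⟩ := h1.unique h2
    rw [← pre_append] at e2
    refine (pre_inj e2 ?_).1.symm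
    simp only [List.length_append, Nat.cast_add] at e1 ⊢
    omega

theorem ext_of_maps {a b : M21} (h : ∀ s d t, a.Maps s d t ↔ b.Maps s d t) : a = b :=
  Subtype.ext <| RIHom.ext_of_le
    (fun _ _ hxy => act_of_maps fun r => (h _ _ _).1 (maps_of_act hxy r))
    (fun _ _ hxy => act_of_maps fun r => (h _ _ _).2 (maps_of_act hxy r))

theorem ext_of_total {a b : M21} (h : ∀ s, ∃ d t, a.Maps s d t ∧ b.Maps s d t) : a = b := by
  refine ext_of_maps fun s d t => ?_
  obtain ⟨d', t', ha, hb⟩ := h s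
  constructor
  · intro h'
    obtain ⟨rfl, rfl⟩ := h'.unique ha
    exact hb
  · intro h'
    obtain ⟨rfl, rfl⟩ := h'.unique hb
    exact ha

theorem maps_total (g : G21) (s : ℕ → Bool) : ∃ d t, (g : M21).Maps s d t := by
  have h := one_maps s
  rw [← g.inv_mul, mul_maps] at h
  obtain ⟨d₁, u, d₂, h1, -, -⟩ := h
  exact ⟨d₁, u, h1⟩

theorem maps_inv {g : G21} {s t : ℕ → Bool} {d : ℤ} (h : (g : M21).Maps s d t) :
    (↑g⁻¹ : M21).Maps t (-d) s := by
  have h1 := one_maps s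
  rw [← g.inv_mul, mul_maps] at h1
  obtain ⟨d₁, u, d₂, h1, h2, h3⟩ := h1
  obtain ⟨rfl, rfl⟩ := h1.unique h
  rwa [show -d₁ = d₂ by omega]

end M21

theorem mem_lpG21_iff {g : G21} : g ∈ lpG21 ↔ ∀ s d t, (g : M21).Maps s d t → d = 0 := by
  constructor
  · rintro h s d t ⟨x, y, r, hxy, -, -, hd⟩
    have := h x y hxy
    omega
  · intro h x y hxy
    have := h _ _ _ (M21.maps_of_act hxy fun _ => false)
    omega

/-! ## Words over a generating set -/

/-- `x` is represented by a word of length at most `n` over `S`. -/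
def HasLen {M : Type*} [Monoid M] (S : Set M) (n : ℕ) (x : M) : Prop :=
  ∃ w : List M, (∀ s ∈ w, s ∈ S) ∧ w.prod = x ∧ w.length ≤ n

section HasLen

variable {M : Type*} [Monoid M] {S S' : Set M} {m n : ℕ} {x y : M}

theorem HasLen.mono (h : HasLen S m x) (hmn : m ≤ n) : HasLen S n x :=
  let ⟨w, h1, h2, h3⟩ := h
  ⟨w, h1, h2, h3.trans hmn⟩

theorem hasLen_one : HasLen S n (1 : M) := ⟨[], by simp, rfl, by simp⟩

theorem hasLen_of_mem (h : x ∈ S) : HasLen S 1 x := ⟨[x], by simpa, by simp, by simp⟩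

theorem HasLen.mul (hx : HasLen S m x) (hy : HasLen S n y) : HasLen S (m + n) (x * y) := by
  obtain ⟨v, h1, rfl, h3⟩ := hx
  obtain ⟨w, h4, rfl, h6⟩ := hy
  refine ⟨v ++ w, fun s hs => ?_, by simp, by simp; omega⟩
  rcases List.mem_append.1 hs with h | h
  exacts [h1 s h, h4 s h]

theorem HasLen.prod {l : List M} (h : ∀ s ∈ l, HasLen S n s) :
    HasLen S (l.length * n) l.prod := by
  induction l with
  | nil => exact hasLen_one
  | cons a l ih =>
    rw [List.prod_cons, List.length_cons, Nat.add_mul, one_mul, add_comm]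
    exact (h a (by simp)).mul (ih fun s hs => h s (by simp [hs]))

theorem HasLen.pow (h : HasLen S m x) (n : ℕ) : HasLen S (n * m) (x ^ n) := by
  have := HasLen.prod (S := S) (n := m) (l := List.replicate n x)
    fun s hs => by rwa [List.eq_of_mem_replicate hs]
  simpa using this

theorem exists_hasLen (h : x ∈ Submonoid.closure S) : ∃ n, HasLen S n x := by
  obtain ⟨w, hw, hx⟩ := Submonoid.exists_list_of_mem_closure h
  exact ⟨w.length, w, hw, hx, le_rfl⟩

theorem exists_hasLen_of_finite {T : Set M} (hT : T.Finite)
    (h : ∀ x ∈ T, x ∈ Submonoid.closure S) : ∃ n, ∀ x ∈ T, HasLen S n x := by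
  choose! N hN using fun x hx => exists_hasLen (h x hx)
  obtain ⟨n, hn⟩ := (hT.image N).bddAbove
  exact ⟨n, fun x hx => (hN x hx).mono (hn ⟨x, hx, rfl⟩)⟩

theorem HasLen.trans (h : HasLen S m x) (h' : ∀ s ∈ S, HasLen S' n s) :
    HasLen S' (m * n) x := by
  obtain ⟨w, h1, rfl, h3⟩ := h
  exact (HasLen.prod fun s hs => h' s (h1 s hs)).mono (Nat.mul_le_mul_right _ h3)

theorem wordLength_le_iff : wordLength S x ≤ n ↔ HasLen S n x := by
  constructor
  · intro h
    by_contra hc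
    have : (n : ℕ∞) + 1 ≤ wordLength S x := by
      refine le_iInf₂ fun w hw => ?_
      by_contra hlt
      rw [not_le] at hlt
      refine hc ⟨w, hw.1, hw.2, ?_⟩
      have : w.length < n + 1 := by exact_mod_cast hlt
      omega
    have h2 := this.trans h
    have : n + 1 ≤ n := by exact_mod_cast h2
    omega
  · rintro ⟨w, h1, h2, h3⟩
    exact (iInf₂_le w ⟨h1, h2⟩).trans (by exact_mod_cast h3)

end HasLen

/-! ## Elements of `lepM_{2,1}` that rewrite a prefix of fixed length -/

/-- The right-ideal homomorphism that replaces the prefix `x` of length `k` by `φ x`. -/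
def locHom (k : ℕ) (φ : Word → Word) : RIHom where
  toFun x := if k ≤ x.length then some (φ (x.take k) ++ x.drop k) else none
  map_append x y z h := by
    split_ifs at h with hk
    rw [← Option.some.inj h, if_pos (by rw [List.length_append]; omega),
      List.take_append_of_le_length hk, List.drop_append_of_le_length hk, List.append_assoc]
  fg := by
    refine ⟨{p | p.length = k}, List.finite_length_eq Bool k, ?_⟩
    ext x
    constructor
    · intro hx
      have hk : k ≤ x.length := by
        by_contra hk
        simp [hk] at hx
      exact ⟨x.take k, by simpa using hk, List.take_prefix _ _⟩
    · rintro ⟨p, hp, hpx⟩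
      have := hpx.length_le
      simp only [Set.mem_ofPred_eq] at hp ⊢
      rw [if_pos (by omega)]
      rfl

theorem locHom_eq_some {k : ℕ} {φ : Word → Word} {x y : Word} :
    (locHom k φ).toFun x = some y ↔ k ≤ x.length ∧ φ (x.take k) ++ x.drop k = y := by
  simp [locHom]

theorem isMaximalPrefixCode_length_eq (k : ℕ) : IsMaximalPrefixCode {x : Word | x.length = k} := by
  refine ⟨fun x hx y hy h => h.eq_of_length (hx.trans hy.symm), fun C hC hsub => ?_⟩
  refine Set.Subset.antisymm (fun y hy => ?_) hsub
  rcases le_total k y.length with h | h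
  · have h1 : y.take k ∈ {x : Word | x.length = k} := by simpa using h
    have := hC _ (hsub h1) y hy (List.take_prefix _ _)
    rwa [← this]
  · have h1 : y ++ List.replicate (k - y.length) false ∈ {x : Word | x.length = k} := by
      simp only [Set.mem_ofPred_eq, List.length_append, List.length_replicate]; omega
    have := hC y hy _ (hsub h1) (List.prefix_append _ _)
    rwa [this]

/-- Constant output length makes every length change equal to `r - k`; this supplies all the
elements of lepM that the simulation uses. -/
theorem locHom_mem_lepM21 {k r : ℕ} {φ : Word → Word}
    (hφ : ∀ x : Word, x.length = k → (φ x).length = r) : M21.ofHom (locHom k φ) ∈ lepM21 := by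
  have hlen : ∀ x y, (locHom k φ).toFun x = some y → k ≤ x.length ∧
      y.length + k = r + x.length := by
    intro x y h
    obtain ⟨h1, rfl⟩ := locHom_eq_some.1 h
    refine ⟨h1, ?_⟩
    rw [List.length_append, hφ _ (by simpa using h1), List.length_drop]
    omega
  refine ⟨locHom k φ, {x | x.length = k}, φ '' {x | x.length = k}, List.finite_length_eq Bool k,
    (List.finite_length_eq Bool k).image _, isMaximalPrefixCode_length_eq k, ?_, ?_, ?_, ?_, rfl⟩
  · rintro _ ⟨x, hx, rfl⟩ _ ⟨y, hy, rfl⟩ h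
    exact h.eq_of_length ((hφ x hx).trans (hφ y hy).symm)
  · ext x
    constructor
    · rintro ⟨y, hy⟩
      exact ⟨x.take k, by simpa using (hlen _ _ hy).1, List.take_prefix _ _⟩
    · rintro ⟨p, hp, hpx⟩
      have := hpx.length_le
      rw [Set.mem_ofPred_eq] at hp
      exact ⟨_, locHom_eq_some.2 ⟨by omega, rfl⟩⟩
  · ext y
    constructor
    · rintro ⟨x, hx⟩
      obtain ⟨h1, rfl⟩ := locHom_eq_some.1 hx
      exact ⟨_, ⟨x.take k, by simpa using h1, rfl⟩, List.prefix_append _ _⟩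
    · rintro ⟨_, ⟨x, hx, rfl⟩, z, rfl⟩
      rw [Set.mem_ofPred_eq] at hx
      refine ⟨x ++ z, locHom_eq_some.2 ⟨by simp [hx], ?_⟩⟩
      rw [← hx]; simp
  · intro x₁ x₂ y₁ y₂ h1 h2 he
    have := hlen _ _ h1
    have := hlen _ _ h2
    omega

theorem locHom_maps (k : ℕ) (φ : Word → Word) (s : ℕ → Bool) :
    (M21.ofHom (locHom k φ)).Maps s (((φ (initWord k s)).length : ℤ) - k)
      (pre (φ (initWord k s)) fun i => s (k + i)) := by
  rw [M21.ofHom_maps]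
  have h : (locHom k φ).toFun (initWord k s) = some (φ (initWord k s)) :=
    locHom_eq_some.2 ⟨by simp, by
      rw [List.take_of_length_le (by simp), List.drop_eq_nil_of_le (by simp), List.append_nil]⟩
  have := RIHom.maps_of_eq h fun i => s (k + i)
  rwa [pre_initWord, length_initWord] at this

/-- The element `x ↦ 0 x`. -/
noncomputable def pushM : M21 := M21.ofHom (locHom 0 fun _ => [false])

/-- The element that removes the first letter. -/
noncomputable def popM : M21 := M21.ofHom (locHom 1 fun _ => [])

theorem pushM_mem : pushM ∈ lepM21 := locHom_mem_lepM21 (r := 1) (by simp)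

theorem popM_mem : popM ∈ lepM21 := locHom_mem_lepM21 (r := 0) (by simp)

theorem pushM_pow_maps (n : ℕ) (s : ℕ → Bool) :
    (pushM ^ n).Maps s n (pre (List.replicate n false) s) := by
  induction n with
  | zero => simpa using M21.one_maps s
  | succ n ih =>
    rw [pow_succ', List.replicate_succ, ← List.singleton_append, pre_append, Nat.cast_succ]
    refine M21.Maps.mul ?_ ih
    simpa [pushM] using locHom_maps 0 (fun _ => [false]) (pre (List.replicate n false) s)

theorem popM_pow_maps (n : ℕ) (s : ℕ → Bool) :
    (popM ^ n).Maps s (-n) (fun i => s (n + i)) := by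
  induction n generalizing s with
  | zero => simpa using M21.one_maps s
  | succ n ih =>
    rw [pow_succ]
    have h1 : popM.Maps s (-1) (fun i => s (1 + i)) := by
      simpa [popM] using locHom_maps 1 (fun _ => []) s
    have := (ih _).mul h1
    convert this using 1
    · push_cast; ring
    · funext i; congr 1; ring

section Simulation

/-! ## Position transpositions acting on sequences -/

theorem pre_swapWord {i j : ℕ} (hij : i < j) {x : Word} (hj : j < x.length) (r : ℕ → Bool) :
    pre (swapWord i j x) r = pre x r ∘ Equiv.swap i j := by
  have hi : i < x.length := hij.trans hj
  have hlen : (swapWord i j x).length = x.length := by simp [swapWord]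
  funext q
  rw [Function.comp_apply]
  rcases lt_or_ge q x.length with h | h
  · rw [pre_of_lt (by rwa [hlen])]
    simp only [swapWord, List.getElem_set, List.getD_eq_getElem _ _ hi,
      List.getD_eq_getElem _ _ hj]
    rcases eq_or_ne j q with rfl | h1
    · simp [pre_of_lt hi]
    · rcases eq_or_ne i q with rfl | h2
      · simp [h1, pre_of_lt hj]
      · rw [Equiv.swap_apply_of_ne_of_ne h2.symm h1.symm, pre_of_lt h]
        simp [h1, h2]
  · rw [Equiv.swap_apply_of_ne_of_ne (by omega) (by omega), pre_of_le (by omega), pre_of_le h,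
      hlen]

theorem tau_maps {i j : ℕ} (hij : i < j) (s : ℕ → Bool) :
    (M21.ofHom (tauHom i j hij)).Maps s 0 (s ∘ Equiv.swap i j) := by
  rw [M21.ofHom_maps]
  have h : (tauHom i j hij).toFun (initWord (j + 1) s) = some (swapWord i j (initWord (j + 1) s)) :=
    if_pos (by simp)
  have := RIHom.maps_of_eq h fun q => s (j + 1 + q)
  rwa [pre_swapWord hij (by simp), pre_initWord,
    show (swapWord i j (initWord (j + 1) s)).length = (initWord (j + 1) s).length by
      simp [swapWord], sub_self] at this

variable {S : Set M21}

theorem exists_swap (hτ : tauM ⊆ S) (i j : ℕ) :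
    ∃ P, HasLen S 1 P ∧ ∀ s, P.Maps s 0 (s ∘ Equiv.swap i j) := by
  rcases lt_trichotomy i j with h | rfl | h
  · exact ⟨_, hasLen_of_mem (hτ ⟨i, j, h, rfl⟩), tau_maps h⟩
  · exact ⟨1, hasLen_one, fun s => by simpa using M21.one_maps s⟩
  · exact ⟨_, hasLen_of_mem (hτ ⟨j, i, h, rfl⟩), fun s => Equiv.swap_comm j i ▸ tau_maps h s⟩

/-- One transposition per position: the swap corrects the value at `k`, and injectivity of `p` keeps
the earlier positions untouched. -/
theorem exists_perm (hτ : tauM ⊆ S) {k : ℕ} (p : ℕ → ℕ) (hp : Set.InjOn p (Set.Iio k)) :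
    ∃ (π : Equiv.Perm ℕ) (P P' : M21), HasLen S k P ∧ HasLen S k P' ∧
      (∀ s, P.Maps s 0 (s ∘ π)) ∧ (∀ s, P'.Maps s 0 (s ∘ π.symm)) ∧ ∀ i < k, π i = p i := by
  induction k with
  | zero =>
    exact ⟨1, 1, 1, hasLen_one, hasLen_one, fun s => M21.one_maps s, fun s => M21.one_maps s,
      by simp⟩
  | succ k ih =>
    obtain ⟨π, P, P', hP, hP', h1, h2, h3⟩ := ih (hp.mono (Set.Iio_subset_Iio (by omega)))
    obtain ⟨R, hR, hRs⟩ := exists_swap hτ k (π.symm (p k))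
    refine ⟨(Equiv.swap k (π.symm (p k))).trans π, R * P, P' * R, ?_, hP'.mul hR,
      fun s => ?_, fun s => ?_, fun i hi => ?_⟩
    · rw [add_comm]; exact hR.mul hP
    · exact (hRs _).mul_zero (h1 s)
    · exact (h2 _).mul_zero (hRs s)
    · rw [Equiv.trans_apply]
      rcases Nat.lt_succ_iff_lt_or_eq.1 hi with h | rfl
      · have hne : i ≠ π.symm (p k) := by
          intro e
          rw [Equiv.eq_symm_apply, h3 i h] at e
          exact h.ne (hp (Set.mem_Iio.2 hi) (Set.mem_Iio.2 (Nat.lt_succ_self k)) e)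
        rw [Equiv.swap_apply_of_ne_of_ne h.ne hne, h3 i h]
      · simp

/-- A map on finitely many letters can be applied at any positions at bounded cost. -/
theorem exists_gate (hτ : tauM ⊆ S) (hS : lepM21 ⊆ Submonoid.closure S) {ι : Type*} [Fintype ι]
    (f : (ι → Bool) → ι → Bool) : ∃ C, ∀ p : ι → ℕ, Function.Injective p →
      ∃ P, HasLen S C P ∧ ∀ T, P.Maps T 0 (Function.extend p (f (T ∘ p)) T) := by
  classical
  let k := Fintype.card ι
  let e : ι ≃ Fin k := Fintype.equivFin ι
  let φ : Word → Word := fun x => List.ofFn fun i : Fin k =>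
    f (fun a => x.getD (e a) false) (e.symm i)
  have hφ : ∀ x : Word, (φ x).length = k := fun x => by simp [φ]
  obtain ⟨c, hc⟩ := exists_hasLen (hS (locHom_mem_lepM21 (k := k) fun x _ => hφ x))
  refine ⟨k + c + k, fun p hp => ?_⟩
  obtain ⟨π, P, P', hP, hP', h1, h2, h3⟩ := exists_perm hτ (k := k)
    (fun i => if h : i < k then p (e.symm ⟨i, h⟩) else 0) (by
      intro i hi j hj hij
      simp only [Set.mem_Iio] at hi hj
      simp only [hi, hj, dite_true] at hij
      simpa using hp hij)
  -- `P` gathers the letters at the positions `p` into the first `k` places, the fixed element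
  -- rewrites them there, and `P'` returns them. The cost does not depend on `p`.
  refine ⟨P' * M21.ofHom (locHom k φ) * P, (hP'.mul hc).mul hP, fun T => ?_⟩
  have hπ : ∀ a, π (e a) = p a := fun a => by rw [h3 _ (e a).2]; simp
  have h4 := locHom_maps k φ (T ∘ π)
  rw [hφ, sub_self] at h4
  have h5 := ((h2 _).mul_zero h4).mul_zero (h1 T)
  convert h5 using 1
  funext q
  rw [Function.comp_apply]
  by_cases hq : ∃ a, p a = q
  · obtain ⟨a, rfl⟩ := hq
    rw [hp.extend_apply, ← hπ a, Equiv.symm_apply_apply, pre_of_lt (by rw [hφ]; exact (e a).2)]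
    simp only [φ, List.getElem_ofFn, Fin.eta, Equiv.symm_apply_apply]
    congr 1
    funext b
    simp [initWord, hπ]
  · rw [Function.extend_apply' _ _ _ hq]
    have hk : k ≤ π.symm q := by
      by_contra hlt
      rw [not_le] at hlt
      refine hq ⟨e.symm ⟨π.symm q, hlt⟩, ?_⟩
      rw [← hπ, Equiv.apply_symm_apply, Equiv.apply_symm_apply]
    rw [pre_of_le (by rwa [hφ]), hφ]
    simp [hk]

/-! ## Simulation of `M_{2,1}` by `lepM_{2,1}` -/

/-- Let `K` bound the lengths of the domain generators and of their images. The prefix of length `K`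
is then a generator `p` followed by some `z` with `|z| ≤ K`, so its image has length at most `2 K`.
-/
theorem M21.exists_window (γ : M21) : ∃ B, ∀ K ≥ B, ∀ s d t, γ.Maps s d t →
    ∃ y : Word, γ.act (initWord K s) = some y ∧ y.length ≤ 2 * K ∧ d = y.length - K ∧
      t = pre y fun i => s (K + i) := by
  obtain ⟨P, hP, hdom⟩ := γ.1.fg
  rw [RIHom.isSome_set_eq] at hdom
  obtain ⟨m, hm⟩ := (hP.image List.length).bddAbove
  obtain ⟨m', hm'⟩ := (hP.image fun p => ((γ.1.toFun p).getD []).length).bddAbove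
  refine ⟨max m m', fun K hK s d t h => ?_⟩
  obtain ⟨x, y, r, hl, hxy, rfl, rfl, hd⟩ := RIHom.Maps.exists_long h K
  obtain ⟨p, hp, hpx⟩ : x ∈ genIdeal P := by rw [← hdom]; exact ⟨y, hxy⟩
  obtain ⟨w, hw⟩ : p ∈ γ.1.dom := by rw [hdom]; exact ⟨p, hp, List.prefix_refl p⟩
  have h1 : p.length ≤ m := hm ⟨p, hp, rfl⟩
  have h2 : w.length ≤ m' := by
    have := hm' ⟨p, hp, rfl⟩
    simpa [hw] using this
  have h3 : p.length ≤ K := by omega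
  obtain ⟨v, hv, -⟩ := pre_split
    (x := initWord K (pre x r)) (y := x) (r' := r) (pre_initWord _ _) (by simpa using hl)
  have hq : p <+: initWord K (pre x r) :=
    List.prefix_of_prefix_length_le hpx ⟨v, hv.symm⟩ (by simpa using h3)
  obtain ⟨z, hz⟩ := hq
  have hz' : z.length ≤ K := by
    have := congrArg List.length hz
    simp at this
    omega
  have hact := γ.1.map_append _ _ z hw
  rw [hz] at hact
  have h4 := maps_of_act hact fun i => pre x r (K + i)
  rw [pre_initWord, length_initWord] at h4
  obtain ⟨e1, e2⟩ := h.unique h4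
  exact ⟨w ++ z, hact, by simp; omega, e1, e2⟩

/-- The locations of the two arrays of `L` flags. -/
def Flags (L c c' : ℕ) : Prop := (c = 0 ∧ c' = L) ∨ (c = L ∧ c' = 0)

/-- The sequence `T` holds the sequence `u` from location `2 L + a` on; of the `L` flags at `c`
exactly the one with index `a` is set, and the `L` flags at `c'` are clear. -/
def Enc (L c c' a : ℕ) (u T : ℕ → Bool) : Prop :=
  (∀ i < L, T (c + i) = decide (i = a)) ∧ (∀ i < L, T (c' + i) = false) ∧
    ∀ i, T (2 * L + a + i) = u i

/-- A sequence of gates of which only one is active. -/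
theorem exists_sequence {C n : ℕ} {F : ℕ → (ℕ → Bool) → ℕ → Bool}
    (hF : ∀ a < n, ∃ P, HasLen S C P ∧ ∀ T, P.Maps T 0 (F a T)) :
    ∃ Q, HasLen S (n * C) Q ∧ (∀ T, (∀ a < n, F a T = T) → Q.Maps T 0 T) ∧
      ∀ T, ∀ a < n, (∀ b < a, F b T = T) → (∀ b < n, F b (F a T) = F a T ∨ b = a) →
        Q.Maps T 0 (F a T) := by
  induction n with
  | zero => exact ⟨1, hasLen_one, fun T _ => M21.one_maps T, by simp⟩
  | succ n ih =>
    obtain ⟨Q, hQ, h1, h2⟩ := ih fun a ha => hF a (by omega)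
    obtain ⟨P, hP, hPF⟩ := hF n (by omega)
    refine ⟨P * Q, by rw [Nat.succ_mul, add_comm]; exact hP.mul hQ, fun T hT => ?_,
      fun T a ha hb hb' => ?_⟩
    · have := hPF T
      rw [hT n (by omega)] at this
      exact this.mul_zero (h1 T fun a ha => hT a (by omega))
    · rcases Nat.lt_succ_iff_lt_or_eq.1 ha with h | rfl
      · have h3 := hPF (F a T)
        rw [(hb' n (by omega)).resolve_right h.ne'] at h3
        exact h3.mul_zero (h2 T a h hb fun b hb => hb' b (by omega))
      · exact (hPF T).mul_zero (h1 T hb)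

theorem extend_self {ι : Type*} {p : ι → ℕ} (hp : Function.Injective p) (T : ℕ → Bool) :
    Function.extend p (T ∘ p) T = T := by
  funext q
  by_cases h : ∃ i, p i = q
  · obtain ⟨i, rfl⟩ := h
    rw [hp.extend_apply]; rfl
  · rw [Function.extend_apply' _ _ _ h]

/-- `w` is simulated at pointer positions at distance at least `K` from the ends of the flag
arrays, at cost `L * C`. -/
def Simulates (S : Set M21) (C K : ℕ) (w : M21) : Prop :=
  ∀ L c c', Flags L c c' → ∃ P c₁ c₁', Flags L c₁ c₁' ∧ HasLen S (L * C) P ∧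
    ∀ a u T d v, Enc L c c' a u T → K ≤ a → a + K < L → w.Maps u d v →
      |d| ≤ K ∧ ∃ (T' : ℕ → Bool) (a' : ℕ), (a' : ℤ) = a - d ∧ P.Maps T 0 T' ∧ Enc L c₁ c₁' a' v T'

/-- A transposition leaves the pointer alone, so gate `a` only swaps two cells behind the pointer,
and the flags keep their places. As gates cost the same at all positions, `C` serves all of τ. -/
theorem exists_simulates_tau (hτ : tauM ⊆ S) (hS : lepM21 ⊆ Submonoid.closure S) :
    ∃ C, ∀ K, ∀ w ∈ tauM, Simulates S C K w := by
  -- `none` is the guarding flag; `some false` and `some true` are the cells of the letters `i` and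
  -- `j`.
  let f : (Option Bool → Bool) → Option Bool → Bool := fun v x =>
    if v none then x.elim true fun b => v (some !b) else v x
  obtain ⟨C, hC⟩ := exists_gate hτ hS f
  refine ⟨C, ?_⟩
  rintro K _ ⟨i, j, hij, rfl⟩ L c c' hc
  let p : ℕ → Option Bool → ℕ := fun a x =>
    x.elim (c + a) fun b => 2 * L + a + if b then j else i
  have hc' : c + L ≤ 2 * L ∧ c' + L ≤ 2 * L := by rcases hc with h | h <;> omega
  have hp : ∀ a < L, Function.Injective (p a) := by
    rintro a ha (_ | _ | _) (_ | _ | _) h <;> simp [p] at h ⊢ <;> omega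
  let F : ℕ → (ℕ → Bool) → ℕ → Bool := fun a T => Function.extend (p a) (f (T ∘ p a)) T
  obtain ⟨Q, hQ, -, hQ2⟩ := exists_sequence (F := F) fun a ha => hC (p a) (hp a ha)
  have hF : ∀ b < L, ∀ T : ℕ → Bool, T (c + b) = false → F b T = T := by
    intro b hb T h
    have : f (T ∘ p b) = T ∘ p b := by
      funext x
      simp [f, p, h]
    simp only [F, this, extend_self (hp b hb)]
  refine ⟨Q, c, c', hc, hQ, fun a u T d v hE _ ha hw => ?_⟩
  obtain ⟨rfl, rfl⟩ := hw.unique (tau_maps hij u)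
  replace ha : a < L := by omega
  obtain ⟨h1, h2, h3⟩ := hE
  have hTa : T (c + a) = true := by rw [h1 a ha]; simp
  have hlow : ∀ q < 2 * L, F a T q = T q := by
    intro q hq
    by_cases h : ∃ x, p a x = q
    · obtain ⟨x, rfl⟩ := h
      simp only [F, (hp a ha).extend_apply]
      match x with
      | none => simp [f, p, hTa]
      | some b => exact absurd hq (by simp [p]; omega)
    · exact Function.extend_apply' _ _ _ h
  have hE' : Enc L c c' a (u ∘ Equiv.swap i j) (F a T) := by
    refine ⟨fun q hq => ?_, fun q hq => ?_, fun q => ?_⟩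
    · rw [hlow _ (by omega), h1 q hq]
    · rw [hlow _ (by omega), h2 q hq]
    · have hsome : ∀ b : Bool, F a T (2 * L + a + if b then j else i) =
          u (if !b then j else i) := by
        intro b
        have := (hp a ha).extend_apply (f (T ∘ p a)) T (some b)
        refine this.trans ?_
        rw [← h3]
        cases b <;> simp [f, p, hTa]
      rw [Function.comp_apply]
      rcases eq_or_ne q i with rfl | hi
      · simpa using hsome false
      · rcases eq_or_ne q j with rfl | hj
        · simpa using hsome true
        · rw [Equiv.swap_apply_of_ne_of_ne hi hj, ← h3]
          refine Function.extend_apply' _ _ _ ?_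
          rintro ⟨_ | _ | _, h⟩ <;> simp [p] at h <;> omega
  refine ⟨by simp, F a T, a, by simp, hQ2 T a ha (fun b hb => hF b (by omega) T ?_)
    (fun b hb => or_iff_not_imp_right.2 fun hne => hF b hb _ ?_), hE'⟩
  · rw [h1 b (by omega)]; simp; omega
  · rw [hE'.1 b hb]; simpa using hne

/-- The old flag is cleared in one array and the new one is set in the other. The two arrays are
needed because a flag written into the array being scanned could trigger a later gate of the same
round. -/
theorem exists_simulates (hτ : tauM ⊆ S) (hS : lepM21 ⊆ Submonoid.closure S) (γ : M21) :
    ∃ B, ∀ K ≥ B, ∃ C, Simulates S C K γ := by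
  obtain ⟨B, hB⟩ := γ.exists_window
  refine ⟨B, fun K hK => ?_⟩
  replace hB := hB K hK
  -- `none` is the guarding flag, `inl` the `2 K + 1` possible flags of the new pointer, `inr` the
  -- `2 K` data cells centred at the pointer. The second half of the data is read, and the output
  -- `y` is written flush right, starting at index `2 K - |y|`. The default `[]` is harmless, as the
  -- claim concerns only sequences on which `γ` is defined.
  let f : (Option (Fin (2 * K + 1) ⊕ Fin (2 * K)) → Bool) →
      Option (Fin (2 * K + 1) ⊕ Fin (2 * K)) → Bool := fun v x =>
    if v none then
      let y := (γ.act (List.ofFn fun i : Fin K => v (some (.inr ⟨K + i, by omega⟩)))).getD []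
      x.elim false (Sum.elim (fun i => decide ((i : ℕ) + y.length = 2 * K))
        fun i => if 2 * K ≤ i + y.length then y.getD (i + y.length - 2 * K) false else false)
    else v x
  obtain ⟨C, hC⟩ := exists_gate hτ hS f
  refine ⟨C, ?_⟩
  rintro L c c' hc
  -- Gate `b` serves the pointer value `b + K`: its window starts `K` cells before the pointer.
  let p : ℕ → Option (Fin (2 * K + 1) ⊕ Fin (2 * K)) → ℕ := fun b x =>
    x.elim (c + b + K) (Sum.elim (fun i => c' + b + i) fun i => 2 * L + b + i)
  have hc' : (c + L ≤ 2 * L ∧ c' + L ≤ 2 * L) ∧ (c + L ≤ c' ∨ c' + L ≤ c) := by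
    rcases hc with h | h <;> omega
  have hp : ∀ b < L - 2 * K, Function.Injective (p b) := by
    rintro b hb (_ | ⟨i, hi⟩ | ⟨i, hi⟩) (_ | ⟨j, hj⟩ | ⟨j, hj⟩) h <;> simp [p] at h ⊢ <;> omega
  let F : ℕ → (ℕ → Bool) → ℕ → Bool := fun a T => Function.extend (p a) (f (T ∘ p a)) T
  obtain ⟨Q, hQ, -, hQ2⟩ := exists_sequence (F := F) fun a ha => hC (p a) (hp a ha)
  have hF : ∀ b < L - 2 * K, ∀ T : ℕ → Bool, T (c + b + K) = false → F b T = T := by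
    intro b hb T h
    have : f (T ∘ p b) = T ∘ p b := by
      funext x
      simp [f, p, h]
    simp only [F, this, extend_self (hp b hb)]
  -- The two flag arrays exchange their roles for the next generator.
  refine ⟨Q, c', c, Or.symm (hc.imp And.symm And.symm), hQ.mono (Nat.mul_le_mul_right _ (by omega)),
    fun a u T d v hE hKa ha hw => ?_⟩
  obtain ⟨y, hy, hyK, rfl, rfl⟩ := hB _ _ _ hw
  obtain ⟨b, rfl⟩ := Nat.exists_eq_add_of_le' hKa
  have hb : b < L - 2 * K := by omega
  obtain ⟨h1, h2, h3⟩ := hE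
  have hTb : T (c + b + K) = true := by rw [add_assoc, h1 _ (by omega)]; simp
  have hword : (List.ofFn fun i : Fin K => T (2 * L + b + (K + i))) = initWord K u := by
    refine List.ext_getElem (by simp) fun i h _ => ?_
    simp only [List.getElem_ofFn, initWord, List.getElem_map, List.getElem_range]
    rw [← h3]; congr 1; omega
  have hin : ∀ x, F b T (p b x) = x.elim false
      (Sum.elim (fun i => decide ((i : ℕ) + y.length = 2 * K))
        fun i => if 2 * K ≤ i + y.length then y.getD (i + y.length - 2 * K) false else false) := by
    intro x
    simp only [F, (hp b hb).extend_apply]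
    simp only [f, Function.comp_apply, p, Option.elim_none, Option.elim_some, Sum.elim_inr, hTb,
      if_true, hword, hy, Option.getD_some]
  have hout : ∀ q, (∀ x, p b x ≠ q) → F b T q = T q := fun q hq =>
    Function.extend_apply' _ _ _ fun ⟨x, hx⟩ => hq x hx
  have hE' : Enc L c' c (b + (2 * K - y.length)) (pre y fun i => u (K + i)) (F b T) := by
    refine ⟨fun q hq => ?_, fun q hq => ?_, fun q => ?_⟩
    · by_cases h : b ≤ q ∧ q < b + 2 * K + 1
      · have := hin (some (.inl ⟨q - b, by omega⟩))
        simp only [p, Option.elim_some, Sum.elim_inl] at this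
        rw [show c' + b + (q - b) = c' + q by omega] at this
        rw [this]
        simp only [decide_eq_decide]
        omega
      · rw [hout, h2 q hq]
        · symm; simp only [decide_eq_false_iff_not]; omega
        · rintro (_ | ⟨i, hi⟩ | ⟨i, hi⟩) <;> simp [p] <;> omega
    · by_cases h : q = b + K
      · subst h
        have := hin none
        simpa [p, add_assoc] using this
      · rw [hout, h1 q hq]
        · simp only [decide_eq_false_iff_not]; omega
        · rintro (_ | ⟨i, hi⟩ | ⟨i, hi⟩) <;> simp [p] <;> omega
    · by_cases h : q < y.length
      · have := hin (some (.inr ⟨2 * K - y.length + q, by omega⟩))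
        simp only [p, Option.elim_some, Sum.elim_inr] at this
        rw [if_pos (by omega), List.getD_eq_getElem _ _ (by omega)] at this
        rw [pre_of_lt h, show 2 * L + (b + (2 * K - y.length)) + q =
          2 * L + b + (2 * K - y.length + q) by omega, this]
        congr 1; omega
      · rw [hout, pre_of_le (by omega), ← h3]
        · congr 1; omega
        · rintro (_ | ⟨i, hi⟩ | ⟨i, hi⟩) <;> simp [p] <;> omega
  refine ⟨by rw [abs_le]; omega, F b T, b + (2 * K - y.length), by omega,
    hQ2 T b hb (fun b' hb' => hF b' (by omega) T ?_) (fun b' hb' => .inl (hF b' hb' _ ?_)), hE'⟩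
  · rw [add_assoc, h1 _ (by omega)]; simp; omega
  · rw [add_assoc, hE'.2.1 _ (by omega)]

/-- Each letter moves the pointer by at most `K`, so a margin of `K` per letter on both sides keeps
every intermediate pointer in range. -/
theorem exists_simulates_list (hτ : tauM ⊆ S) (hS : lepM21 ⊆ Submonoid.closure S) {Γ : Set M21}
    (hΓ : Γ.Finite) : ∃ C K, ∀ ws : List M21, (∀ w ∈ ws, w ∈ Γ ∪ tauM) → ∀ L c c',
      Flags L c c' → ∃ P c₁ c₁', Flags L c₁ c₁' ∧ HasLen S (ws.length * (L * C)) P ∧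
        ∀ a u T d v, Enc L c c' a u T → ws.length * K ≤ a → a + ws.length * K < L →
          ws.prod.Maps u d v → |d| ≤ ws.length * K ∧ ∃ (T' : ℕ → Bool) (a' : ℕ),
            (a' : ℤ) = a - d ∧ P.Maps T 0 T' ∧ Enc L c₁ c₁' a' v T' := by
  obtain ⟨C₀, hC₀⟩ := exists_simulates_tau hτ hS
  choose B hB using exists_simulates hτ hS
  obtain ⟨K, hK⟩ := (hΓ.image B).bddAbove
  choose! C hC using fun γ (hγ : γ ∈ Γ) => hB γ K (hK ⟨γ, hγ, rfl⟩)
  obtain ⟨C₁, hC₁⟩ := (hΓ.image C).bddAbove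
  have hmono : ∀ {C C' w}, Simulates S C K w → C ≤ C' → Simulates S C' K w := by
    intro C C' w h hCC L c c' hc
    obtain ⟨P, c₁, c₁', h1, h2, h3⟩ := h L c c' hc
    exact ⟨P, c₁, c₁', h1, h2.mono (Nat.mul_le_mul_left _ hCC), h3⟩
  have hsim : ∀ w ∈ Γ ∪ tauM, Simulates S (max C₀ C₁) K w := by
    rintro w (hw | hw)
    · exact hmono (hC w hw) ((hC₁ ⟨w, hw, rfl⟩).trans (le_max_right _ _))
    · exact hmono (hC₀ K w hw) (le_max_left _ _)
  refine ⟨max C₀ C₁, K, fun ws => ?_⟩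
  induction ws with
  | nil =>
    intro _ L c c' hc
    refine ⟨1, c, c', hc, hasLen_one, fun a u T d v hE _ _ hw => ?_⟩
    obtain ⟨rfl, rfl⟩ := hw.unique (M21.one_maps u)
    exact ⟨by simp, T, a, by simp, M21.one_maps T, hE⟩
  | cons w ws ih =>
    intro hws L c c' hc
    obtain ⟨P, c₁, c₁', hc₁, hP, h1⟩ := ih (fun w hw => hws w (by simp [hw])) L c c' hc
    obtain ⟨P', c₂, c₂', hc₂, hP', h2⟩ := hsim w (hws w (by simp)) L c₁ c₁' hc₁
    refine ⟨P' * P, c₂, c₂', hc₂, ?_, fun a u T d v hE ha ha' hw => ?_⟩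
    · rw [List.length_cons, Nat.succ_mul, add_comm]
      exact hP'.mul hP
    · rw [List.length_cons] at ha ha' ⊢
      rw [Nat.succ_mul] at ha ha'
      rw [List.prod_cons, M21.mul_maps] at hw
      obtain ⟨d₁, u', d₂, hw1, hw2, rfl⟩ := hw
      obtain ⟨hd₁, T₁, a₁, ha₁, hm₁, hE₁⟩ := h1 _ _ _ _ _ hE (by omega) (by omega) hw1
      have hd₁' := abs_le.1 hd₁
      have hcast : ((ws.length * K : ℕ) : ℤ) = ws.length * K := by push_cast; rfl
      rw [← hcast] at hd₁'
      obtain ⟨hd₂, T₂, a₂, ha₂, hm₂, hE₂⟩ := h2 _ _ _ _ _ hE₁ (by omega) (by omega) hw2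
      have hd₂' := abs_le.1 hd₂
      refine ⟨?_, T₂, a₂, by omega, hm₂.mul_zero hm₁, hE₂⟩
      rw [Nat.cast_add, Nat.cast_one, add_mul, one_mul, ← hcast, abs_le]
      omega

/-! ### The quadratic comparison of word-lengths -/

/-- The length-preserving elements of `G_{2,1}` have at most quadratically larger word-length
over generators of `lepM_{2,1}` than over generators of `M_{2,1}`. -/
theorem exists_hasLen_quadratic (hτ : tauM ⊆ S) (hS : lepM21 ⊆ Submonoid.closure S)
    {Γ : Set M21} (hΓ : Γ.Finite) : ∃ C, 1 ≤ C ∧ ∀ n, ∀ g ∈ lpG21,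
      HasLen (Γ ∪ tauM) n (g : M21) → HasLen S (C * n ^ 2) (g : M21) := by
  obtain ⟨C, K, hC⟩ := exists_simulates_list hτ hS hΓ
  obtain ⟨A, hA⟩ := exists_gate hτ hS (ι := Unit) fun _ _ => true
  obtain ⟨B, hB⟩ := exists_hasLen (hS pushM_mem)
  obtain ⟨B', hB'⟩ := exists_hasLen (hS popM_mem)
  refine ⟨1 + (5 * K + 2) * (B + B') + (2 * K + 1) * C + A, by omega, fun n g hg h => ?_⟩
  obtain ⟨ws, hws, hprod, hn⟩ := h
  -- For `n = 0` the bound is 0 and cannot absorb the additive constants.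
  rcases Nat.eq_zero_or_pos n with rfl | hpos
  · obtain rfl := List.eq_nil_of_length_eq_zero (Nat.le_zero.1 hn)
    rw [← hprod]
    exact hasLen_one
  -- The pointer starts at `n K` and drifts by at most `n K` either way. The padding `W` holds the
  -- two flag arrays and the `n K` cells before the pointer.
  set L := 2 * (n * K) + 1 with hL
  set W := 2 * L + n * K with hW
  obtain ⟨P, c₁, c₁', -, hP, hsim⟩ := hC ws hws L 0 L (.inl ⟨rfl, rfl⟩)
  obtain ⟨G, hG, hGm⟩ := hA (fun _ => n * K) fun _ _ _ => Subsingleton.elim _ _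
  have hwK : ws.length * K ≤ n * K := Nat.mul_le_mul_right _ hn
  -- Push the padding, set the initial flag by `G`, simulate, and pop the padding.
  have key : (g : M21) = popM ^ W * P * G * pushM ^ W := by
    refine M21.ext_of_total fun s => ?_
    obtain ⟨d, t, hm⟩ := M21.maps_total g s
    obtain rfl := mem_lpG21_iff.1 hg _ _ _ hm
    refine ⟨0, t, hm, ?_⟩
    set T := pre (List.replicate W false) s with hT
    have hT0 : ∀ q < W, T q = false := fun q hq => by rw [hT, pre_of_lt (by simpa)]; simp
    have hE : Enc L 0 L (n * K) s
        (Function.extend (fun _ : Unit => n * K) (fun _ => true) T) := by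
      have hout : ∀ q, q ≠ n * K →
          Function.extend (fun _ : Unit => n * K) (fun _ => true) T q = T q := fun q hq =>
        Function.extend_apply' _ _ _ fun ⟨_, h⟩ => hq h.symm
      refine ⟨fun i hi => ?_, fun i hi => ?_, fun i => ?_⟩
      · rw [zero_add]
        by_cases h : i = n * K
        · subst h
          simpa using Function.Injective.extend_apply (f := fun _ : Unit => n * K)
            (fun _ _ _ => Subsingleton.elim _ _) (fun _ => true) T ()
        · rw [hout _ h, hT0 _ (by omega)]
          simpa using h
      · rw [hout _ (by omega), hT0 _ (by omega)]
      · rw [hout _ (by omega), hT, pre_of_le (by simp; omega)]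
        congr 1; simp; omega
    rw [← hprod] at hm
    obtain ⟨-, T', a', ha', hm', hE'⟩ := hsim _ _ _ _ _ hE hwK (by omega) hm
    -- The total change of length is 0, so the result starts exactly at location `W`.
    obtain rfl : a' = n * K := by omega
    have h1 := popM_pow_maps W T'
    have h2 : (fun i => T' (W + i)) = t := funext hE'.2.2
    rw [h2] at h1
    have := ((h1.mul hm').mul (hGm T)).mul (pushM_pow_maps W s)
    simpa using this
  rw [key]
  refine ((((hB'.pow W).mul hP).mul hG).mul (hB.pow W)).mono ?_
  have hW' : W ≤ (5 * K + 2) * n := by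
    rw [hW, hL]; nlinarith
  have hL' : L ≤ (2 * K + 1) * n := by
    rw [hL]; nlinarith
  have h1 : W * (B + B') ≤ (5 * K + 2) * n * (B + B') := Nat.mul_le_mul_right _ hW'
  have h2 : ws.length * (L * C) ≤ n * ((2 * K + 1) * n * C) :=
    Nat.mul_le_mul hn (Nat.mul_le_mul_right _ hL')
  have h3 : n ≤ n ^ 2 := Nat.le_self_pow two_ne_zero n
  have h4 : (5 * K + 2) * (B + B') * n ≤ (5 * K + 2) * (B + B') * n ^ 2 :=
    Nat.mul_le_mul_left _ h3
  have h5 : A * 1 ≤ A * n ^ 2 := Nat.mul_le_mul_left _ (by omega)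
  calc W * B' + ws.length * (L * C) + A + W * B
      = W * (B + B') + ws.length * (L * C) + A * 1 := by ring
    _ ≤ (5 * K + 2) * (B + B') * n ^ 2 + n * ((2 * K + 1) * n * C) + A * n ^ 2 := by
        refine add_le_add (add_le_add (h1.trans ?_) h2) h5
        rw [mul_right_comm]; exact h4
    _ ≤ (1 + (5 * K + 2) * (B + B') + (2 * K + 1) * C + A) * n ^ 2 := by
        ring_nf; omega

end Simulation

/-! ## Cosets of the fixator of `0 A*` -/

theorem mem_fix0_iff {g : G21} :
    g ∈ fix0 ↔ ∀ s, (g : M21).Maps (pre [false] s) 0 (pre [false] s) := by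
  constructor
  · intro h s
    simpa using M21.maps_of_act (h []) s
  · intro h x
    refine M21.act_of_maps fun r => ?_
    rw [← List.singleton_append, pre_append, sub_self]
    exact h _

/-- A coset of `fix0` records exactly the action on sequences that start with 0; `maps_of_mk_eq` is
the converse. -/
theorem mk_eq_of_maps {a b : G21} (h : ∀ s, ∃ d t, (a : M21).Maps (pre [false] s) d t ∧
    (b : M21).Maps (pre [false] s) d t) : (a : G21 ⧸ fix0) = b := by
  rw [QuotientGroup.eq, mem_fix0_iff]
  intro s
  obtain ⟨d, t, ha, hb⟩ := h s
  have := (M21.maps_inv ha).mul hb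
  rwa [add_neg_cancel] at this

theorem maps_of_mk_eq {a b : G21} (h : (a : G21 ⧸ fix0) = b) {s t : ℕ → Bool} {d : ℤ}
    (hb : (b : M21).Maps (pre [false] s) d t) : (a : M21).Maps (pre [false] s) d t := by
  obtain ⟨d', t', ha⟩ := M21.maps_total a (pre [false] s)
  rw [QuotientGroup.eq, mem_fix0_iff] at h
  have h1 := ha.mul (h s)
  rw [← Units.val_mul, mul_inv_cancel_left] at h1
  obtain ⟨rfl, rfl⟩ := h1.unique hb
  simpa using ha

theorem lift0_maps {g : G21} {s t : ℕ → Bool} {d : ℤ} (h : (g : M21).Maps s d t) :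
    (lift0 g : M21).Maps (pre [false] s) d (pre [false] t) := by
  obtain ⟨x, y, r, hxy, rfl, rfl, hd⟩ := h
  have : (M21.ofHom (lift0Hom (g : M21).1)).Maps (pre [false] (pre x r)) d
      (pre [false] (pre y r)) := by
    rw [M21.ofHom_maps]
    refine ⟨false :: x, false :: y, r, ?_, by rw [← pre_append]; rfl, by rw [← pre_append]; rfl,
      by simp [hd]; ring⟩
    rw [lift0Hom_false, hxy]
    rfl
  exact this

/-- At most `n` generators lead from `Fix(0)` to `(g)_0 Fix(0)`. -/
def CosetLen (S : Set G21) (n : ℕ) (g : G21) : Prop :=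
  ∃ w, HasLen S n w ∧ (w : G21 ⧸ fix0) = (lift0 g : G21 ⧸ fix0)

variable {S : Set G21}

theorem CosetLen.mono {m n : ℕ} {g : G21} (h : CosetLen S m g) (hmn : m ≤ n) :
    CosetLen S n g :=
  let ⟨w, h1, h2⟩ := h
  ⟨w, h1.mono hmn, h2⟩

/-- Representatives may be multiplied although `fix0` is not normal: `lift0 h` maps sequences
starting with 0 to such sequences, and there any representative of the coset of `lift0 g` acts as
`lift0 g`. -/
theorem CosetLen.mul {m n : ℕ} {g h : G21} (hg : CosetLen S m g) (hh : CosetLen S n h) :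
    CosetLen S (m + n) (g * h) := by
  obtain ⟨v, hv, hv'⟩ := hg
  obtain ⟨w, hw, hw'⟩ := hh
  refine ⟨v * w, hv.mul hw, mk_eq_of_maps fun s => ?_⟩
  obtain ⟨d, t, ht⟩ := M21.maps_total h s
  obtain ⟨e, u, hu⟩ := M21.maps_total g t
  refine ⟨_, _, (maps_of_mk_eq hv' (lift0_maps hu)).mul (maps_of_mk_eq hw' (lift0_maps ht)), ?_⟩
  rw [map_mul]
  exact (lift0_maps hu).mul (lift0_maps ht)

theorem CosetLen.schreierDist_le {n : ℕ} {g : G21} (h : CosetLen S n g) :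
    schreierDist S 1 g ≤ n := by
  obtain ⟨_, ⟨w, hw, rfl, hn⟩, hg⟩ := h
  -- The path visits the cosets of the products of the last `i` letters of `w`.
  refine le_trans (iInf₂_le w.length ⟨fun i => ((w.drop (w.length - i)).prod : G21), ?_, ?_, ?_⟩)
    (by exact_mod_cast hn)
  · simp
  · simpa using hg
  · intro i hi
    have hlt : w.length - (i + 1) < w.length := by omega
    refine ⟨w[w.length - (i + 1)], hw _ (List.getElem_mem hlt),
      (w.drop (w.length - i)).prod, rfl, ?_⟩
    have : w.length - i = w.length - (i + 1) + 1 := by omega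
    simp only
    rw [this, ← List.prod_cons, ← List.drop_eq_getElem_cons hlt]

/-- The position transposition as an element of `G_{2,1}`. -/
noncomputable def tauUnit (i j : ℕ) (hij : i < j) : G21 :=
  ⟨M21.ofHom (tauHom i j hij), M21.ofHom (tauHom i j hij), tau_mul_self i j hij,
    tau_mul_self i j hij⟩

theorem tauUnit_mem (i j : ℕ) (hij : i < j) : tauUnit i j hij ∈ tauG := ⟨i, j, hij, rfl⟩

theorem tauUnit_maps (i j : ℕ) (hij : i < j) (s : ℕ → Bool) :
    (tauUnit i j hij : M21).Maps s 0 (s ∘ Equiv.swap i j) := tau_maps hij s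

theorem tauUnit_mul_self (i j : ℕ) (hij : i < j) : tauUnit i j hij * tauUnit i j hij = 1 :=
  Units.ext (tau_mul_self i j hij)

/-- On sequences starting with 0, the lift of a transposition is the transposition of the positions
shifted by one, again a generator. -/
theorem cosetLen_tauUnit (hτ : tauG ⊆ S) (i j : ℕ) (hij : i < j) :
    CosetLen S 1 (tauUnit i j hij) := by
  refine ⟨tauUnit (i + 1) (j + 1) (by omega), hasLen_of_mem (hτ (tauUnit_mem _ _ _)),
    mk_eq_of_maps fun s => ⟨_, _, tauUnit_maps _ _ _ _, ?_⟩⟩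
  convert lift0_maps (tauUnit_maps i j hij s) using 1
  funext q
  cases q with
  | zero =>
    rw [Function.comp_apply, Equiv.swap_apply_of_ne_of_ne (by omega) (by omega)]
    rfl
  | succ q =>
    have hsucc : ∀ (u : ℕ → Bool) k, pre [false] u (k + 1) = u k := fun u k => by simp [pre]
    rw [hsucc, Function.comp_apply, Function.comp_apply]
    rcases eq_or_ne q i with rfl | hi
    · simp [hsucc]
    · rcases eq_or_ne q j with rfl | hj
      · simp [hsucc]
      · rw [Equiv.swap_apply_of_ne_of_ne hi hj,
          Equiv.swap_apply_of_ne_of_ne (by omega) (by omega), hsucc]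

theorem exists_cosetLen (hinv : ∀ s ∈ S, s⁻¹ ∈ S) (hgen : Subgroup.closure S = ⊤) (g : G21) :
    ∃ n, CosetLen S n g := by
  have h : lift0 g ∈ Subgroup.closure S := hgen ▸ Subgroup.mem_top _
  rw [← Subgroup.mem_toSubmonoid, Subgroup.closure_toSubmonoid] at h
  obtain ⟨l, hl, hp⟩ := Submonoid.exists_list_of_mem_closure h
  refine ⟨l.length, lift0 g, ⟨l, fun s hs => ?_, hp, le_rfl⟩, rfl⟩
  rcases hl s hs with h | h
  · exact h
  · simpa using hinv _ (Set.mem_inv.1 h)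

/-! ## Supports -/

/-- `a` shifts the letters by `d` positions, except that the letters at the positions in `A`
(after undoing the shift) are rewritten in a way that depends on the letters in `A` only. -/
def ShiftSupported (a : M21) (A : Finset ℤ) (d : ℤ) : Prop :=
  ∃ F : (ℕ → Bool) → ℕ → Bool, (∀ s, a.Maps s d (F s)) ∧
    (∀ s (j : ℕ), (j : ℤ) - d ∉ A → ∃ i : ℕ, (i : ℤ) = j - d ∧ F s j = s i) ∧
    ∀ s s', (∀ i : ℕ, (i : ℤ) ∈ A → s i = s' i) → ∀ j : ℕ, (j : ℤ) - d ∈ A → F s j = F s' j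

theorem shiftSupported_one : ShiftSupported 1 ∅ 0 :=
  ⟨fun s => s, M21.one_maps, fun _ j _ => ⟨j, by simp, rfl⟩, by simp⟩

/-- Position `i` of the intermediate sequence corresponds to `i - e` in the original coordinates, so
supports unite after a translation and their cardinalities are subadditive. -/
theorem ShiftSupported.mul {a b : M21} {A B : Finset ℤ} {d e : ℤ} (ha : ShiftSupported a A d)
    (hb : ShiftSupported b B e) :
    ShiftSupported (a * b) (B ∪ A.image (· - e)) (e + d) := by
  obtain ⟨F, hF, hF1, hF2⟩ := ha
  obtain ⟨G, hG, hG1, hG2⟩ := hb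
  have hmem : ∀ z : ℤ, z ∈ A.image (· - e) ↔ z + e ∈ A := fun z => by
    simp [sub_eq_iff_eq_add]
  refine ⟨fun s => F (G s), fun s => (hF _).mul (hG s), fun s j hj => ?_, fun s s' h j hj => ?_⟩
  · rw [Finset.mem_union, not_or, hmem] at hj
    obtain ⟨i, hi, h1⟩ := hF1 (G s) j fun h => hj.2 (by convert h using 1; ring)
    obtain ⟨k, hk, h2⟩ := hG1 s i fun h => hj.1 (by convert h using 1; omega)
    exact ⟨k, by omega, h1.trans h2⟩
  · have hG' : ∀ i : ℕ, (i : ℤ) - e ∈ B ∪ A.image (· - e) → G s i = G s' i := by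
      intro i hi
      by_cases hB : (i : ℤ) - e ∈ B
      · exact hG2 s s' (fun i hi => h i (Finset.mem_union_left _ hi)) i hB
      · obtain ⟨k, hk, h2⟩ := hG1 s i hB
        obtain ⟨k', hk', h2'⟩ := hG1 s' i hB
        obtain rfl : k = k' := by omega
        rw [h2, h2']
        exact h k (hk ▸ hi)
    by_cases hA : (j : ℤ) - d ∈ A
    · refine hF2 _ _ (fun i hi => hG' i (Finset.mem_union_right _ ?_)) j hA
      rw [hmem]; simpa using hi
    · obtain ⟨k, hk, h2⟩ := hF1 (G s) j hA
      obtain ⟨k', hk', h2'⟩ := hF1 (G s') j hA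
      obtain rfl : k = k' := by omega
      simp only [h2, h2']
      refine hG' k ?_
      rwa [hk, sub_sub, add_comm]

theorem shiftSupported_tau (i j : ℕ) (hij : i < j) :
    ShiftSupported (M21.ofHom (tauHom i j hij)) {(i : ℤ), (j : ℤ)} 0 := by
  refine ⟨fun s => s ∘ Equiv.swap i j, tau_maps hij, fun s q hq => ⟨q, by simp, ?_⟩,
    fun s s' h q hq => ?_⟩
  · simp only [sub_zero, Finset.mem_insert, Nat.cast_inj, Finset.mem_singleton, not_or] at hq
    simp only [Function.comp_apply, Equiv.swap_apply_of_ne_of_ne hq.1 hq.2]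
  · simp only [sub_zero, Finset.mem_insert, Nat.cast_inj, Finset.mem_singleton] at hq
    rcases hq with rfl | rfl
    · simpa using h j (by simp)
    · simpa using h i (by simp)

/-- A word at least as long as every element of `P` must have a prefix in `P`, since otherwise it
could be added to the maximal code. So all words of length `m` lie in the domain, and their images
have equal length. -/
theorem exists_act_of_mem_lepM21 {a : M21} (ha : a ∈ lepM21) :
    ∃ (m : ℕ) (d : ℤ), ∀ x : Word, x.length = m →
      ∃ y, a.act x = some y ∧ (y.length : ℤ) = m + d := by
  obtain ⟨f, P, Q, hP, -, hPmax, -, hdom, -, hlep, rfl⟩ := ha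
  obtain ⟨m, hm⟩ := (hP.image List.length).bddAbove
  have hdom' : ∀ x : Word, m ≤ x.length → x ∈ f.dom := by
    intro x hx
    rw [hdom]
    by_contra hc
    have hcode : IsPrefixCode (insert x P) := by
      have hlt : ∀ p ∈ P, ¬ p <+: x := fun p hp h => hc ⟨p, hp, h⟩
      rintro u (rfl | hu) v (rfl | hv) h
      · rfl
      · have := h.length_le
        have := hm ⟨v, hv, rfl⟩
        exact h.eq_of_length (by omega)
      · exact absurd h (hlt u hu)
      · exact hPmax.1 u hu v hv h
    have := hPmax.2 _ hcode (Set.subset_insert _ _)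
    have hx : x ∈ P := this ▸ Set.mem_insert x P
    exact hc ⟨x, hx, List.prefix_refl x⟩
  obtain ⟨y₀, hy₀⟩ := hdom' (List.replicate m false) (by simp)
  refine ⟨m, y₀.length - m, fun x hx => ?_⟩
  obtain ⟨y, hy⟩ := hdom' x hx.ge
  have := hlep _ _ _ _ hy hy₀ (by simp [hx])
  exact ⟨y, f.essRestr_maxExt.1 _ _ hy, by omega⟩

theorem exists_shiftSupported {a : M21} (ha : a ∈ lepM21) :
    ∃ A d, ShiftSupported a A d := by
  obtain ⟨m, d, h⟩ := exists_act_of_mem_lepM21 ha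
  choose! φ hφ using h
  -- If `d > 0`, the first `d` output positions come from negative input positions; hence supports
  -- live in `ℤ`.
  refine ⟨Finset.Ico (-|d|) m, d,
    fun s => pre (φ (initWord m s)) fun i => s (m + i), fun s => ?_, fun s j hj => ?_,
    fun s s' h j hj => ?_⟩
  · obtain ⟨h1, h2⟩ := hφ (initWord m s) (by simp)
    have := M21.maps_of_act h1 fun i => s (m + i)
    rwa [pre_initWord, h2, length_initWord, add_sub_cancel_left] at this
  · obtain ⟨h1, h2⟩ := hφ (initWord m s) (by simp)
    have := le_abs_self d
    rw [Finset.mem_Ico, not_and_or] at hj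
    refine ⟨(j - d).toNat, by omega, ?_⟩
    simp only
    rw [pre_of_le (by omega)]
    congr 1; omega
  · obtain ⟨h1, h2⟩ := hφ (initWord m s) (by simp)
    rw [Finset.mem_Ico] at hj
    have e : initWord m s = initWord m s' := by
      refine List.map_congr_left fun i hi => h i ?_
      rw [List.mem_range] at hi
      rw [Finset.mem_Ico]
      have := abs_nonneg d
      omega
    simp only
    rw [← e, pre_of_lt (by omega), pre_of_lt (by omega)]

/-! ### Unshifted supports and finiteness of the distances -/

/-- `a` permutes the assignments of letters to the positions in `A`, and nothing else. -/
def SupportedOn (a : M21) (A : Finset ℕ) : Prop :=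
  ∃ F : (ℕ → Bool) → ℕ → Bool, (∀ s, a.Maps s 0 (F s)) ∧ (∀ s, ∀ j ∉ A, F s j = s j) ∧
    ∀ s s', (∀ i ∈ A, s i = s' i) → ∀ j ∈ A, F s j = F s' j

/-- Supports of generators have bounded size, uniformly over the infinite set τ, so a product of `n`
of them has support O(n). Length preservation forces the total shift to be 0. -/
theorem exists_supportedOn {Γ : Set M21} (hΓ : Γ.Finite) (hΓL : Γ ⊆ lepM21) :
    ∃ c, ∀ n, ∀ g ∈ lpG21, HasLen (Γ ∪ tauM) n (g : M21) →
      ∃ A : Finset ℕ, A.card ≤ n * c ∧ SupportedOn g A := by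
  choose! A d hA using fun a (ha : a ∈ Γ) => exists_shiftSupported (hΓL ha)
  obtain ⟨c, hc⟩ := (hΓ.image fun a => (A a).card).bddAbove
  have hgen : ∀ a ∈ Γ ∪ tauM, ∃ A d, A.card ≤ max c 2 ∧ ShiftSupported a A d := by
    rintro a (ha | ⟨i, j, hij, rfl⟩)
    · exact ⟨_, _, (hc ⟨a, ha, rfl⟩).trans (le_max_left _ _), hA a ha⟩
    · exact ⟨_, _, Finset.card_le_two.trans (le_max_right _ _), shiftSupported_tau i j hij⟩
  refine ⟨max c 2, ?_⟩
  rintro n g hg ⟨w, hw, hprod, hn⟩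
  have hlist : ∃ A d, A.card ≤ w.length * max c 2 ∧ ShiftSupported w.prod A d := by
    clear hprod hn
    induction w with
    | nil => exact ⟨∅, 0, by simp, shiftSupported_one⟩
    | cons a w ih =>
      obtain ⟨B, e, hB, hBe⟩ := ih fun s hs => hw s (by simp [hs])
      obtain ⟨A, d, hA, hAd⟩ := hgen a (hw a (by simp))
      refine ⟨_, _, ?_, List.prod_cons (a := a) (l := w) ▸ hAd.mul hBe⟩
      rw [List.length_cons, Nat.succ_mul]
      exact (Finset.card_union_le _ _).trans (add_le_add hB (Finset.card_image_le.trans hA))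
  obtain ⟨A, d, hcard, F, hF, hF1, hF2⟩ := hlist
  rw [hprod] at hF
  obtain rfl := mem_lpG21_iff.1 hg _ _ _ (hF fun _ => false)
  have hmem : ∀ i : ℕ, i ∈ A.preimage (Nat.cast : ℕ → ℤ) Nat.cast_injective.injOn ↔
    (i : ℤ) ∈ A := fun i => Finset.mem_preimage
  refine ⟨A.preimage (Nat.cast : ℕ → ℤ) Nat.cast_injective.injOn, ?_, F, hF, fun s j hj => ?_,
    fun s s' h j hj => ?_⟩
  · refine le_trans ?_ (hcard.trans (Nat.mul_le_mul_right _ hn))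
    exact Finset.card_le_card_of_injOn Nat.cast (fun i hi => (hmem i).1 hi)
      Nat.cast_injective.injOn
  · rw [hmem] at hj
    obtain ⟨i, hi, h⟩ := hF1 s j (by simpa using hj)
    obtain rfl : i = j := by omega
    exact h
  · exact hF2 s s' (fun i hi => h i ((hmem i).2 hi)) j (by simpa using (hmem j).1 hj)

theorem SupportedOn.conj {g : G21} {A : Finset ℕ} (h : SupportedOn g A) (i j : ℕ) (hij : i < j) :
    SupportedOn (tauUnit i j hij * g * tauUnit i j hij : G21)
      (A.map (Equiv.swap i j).toEmbedding) := by
  obtain ⟨F, hF, hF1, hF2⟩ := h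
  have hmem : ∀ q, q ∈ A.map (Equiv.swap i j).toEmbedding ↔ Equiv.swap i j q ∈ A := fun q => by
    rw [Finset.mem_map_equiv, Equiv.symm_swap]
  refine ⟨fun s => F (s ∘ Equiv.swap i j) ∘ Equiv.swap i j,
    fun s => ((tauUnit_maps i j hij _).mul_zero (hF _)).mul_zero (tauUnit_maps i j hij s),
    fun s q hq => ?_, fun s s' h q hq => ?_⟩
  · rw [hmem] at hq
    simp [hF1 _ _ hq]
  · refine hF2 _ _ (fun k hk => h _ ?_) _ ((hmem q).1 hq)
    rw [hmem]
    simpa using hk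

/-- Each conjugation by a transposition brings one stray position into the range and costs at most 2
in coset length. -/
theorem exists_conj_supportedOn_range (hτ : tauG ⊆ S) {r : ℕ} (m : ℕ) {g : G21} {A : Finset ℕ}
    (hg : SupportedOn g A) (hA : A.card ≤ r) (hm : (A \ Finset.range r).card ≤ m) :
    ∃ g' : G21, SupportedOn g' (Finset.range r) ∧
      ∀ B, CosetLen S B g' → CosetLen S (B + 2 * m) g := by
  induction m generalizing g A with
  | zero =>
    refine ⟨g, ?_, fun B h => h⟩
    have hsub : A ⊆ Finset.range r := by
      rw [← Finset.sdiff_eq_empty_iff_subset]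
      exact Finset.card_eq_zero.1 (Nat.le_zero.1 hm)
    obtain ⟨F, hF, hF1, hF2⟩ := hg
    refine ⟨F, hF, fun s j hj => hF1 s j fun h => hj (hsub h), fun s s' h j hj => ?_⟩
    by_cases hjA : j ∈ A
    · exact hF2 s s' (fun i hi => h i (hsub hi)) j hjA
    · rw [hF1 s j hjA, hF1 s' j hjA, h j hj]
  | succ m ih =>
    by_cases hle : (A \ Finset.range r).card ≤ m
    · obtain ⟨g', h1, h2⟩ := ih hg hA hle
      exact ⟨g', h1, fun B hB => (h2 B hB).mono (by omega)⟩
    obtain ⟨e, he⟩ : (A \ Finset.range r).Nonempty := by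
      rw [← Finset.card_pos]; omega
    have he' := Finset.mem_sdiff.1 he
    -- As `A` has at most `r` elements and one lies outside the range, some place in the range is
    -- free.
    obtain ⟨b, hb, hbA⟩ : ∃ b ∈ Finset.range r, b ∉ A := by
      by_contra! hc
      have h1 : insert e (Finset.range r) ⊆ A := Finset.insert_subset he'.1 hc
      have h2 := Finset.card_le_card h1
      rw [Finset.card_insert_of_notMem he'.2, Finset.card_range] at h2
      omega
    have hbe : b < e := by
      have h1 := he'.2
      rw [Finset.mem_range] at h1 hb
      omega
    have hsub : A.map (Equiv.swap b e).toEmbedding \ Finset.range r ⊆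
        (A \ Finset.range r).erase e := by
      intro q hq
      rw [Finset.mem_sdiff, Finset.mem_map_equiv, Equiv.symm_swap] at hq
      have hqb : q ≠ b := fun h => hq.2 (h ▸ hb)
      have hqe : q ≠ e := by
        rintro rfl
        rw [Equiv.swap_apply_right] at hq
        exact hbA hq.1
      rw [Equiv.swap_apply_of_ne_of_ne hqb hqe] at hq
      exact Finset.mem_erase.2 ⟨hqe, Finset.mem_sdiff.2 hq⟩
    have hcard := Finset.card_le_card hsub
    rw [Finset.card_erase_of_mem he] at hcard
    obtain ⟨g', h1, h2⟩ := ih (hg.conj b e hbe) (by simpa using hA) (by omega)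
    refine ⟨g', h1, fun B hB => ?_⟩
    have h3 := ((cosetLen_tauUnit hτ b e hbe).mul (h2 B hB)).mul (cosetLen_tauUnit hτ b e hbe)
    have h4 : tauUnit b e hbe * (tauUnit b e hbe * g * tauUnit b e hbe) * tauUnit b e hbe = g := by
      rw [← mul_assoc, ← mul_assoc, tauUnit_mul_self, one_mul, mul_assoc, tauUnit_mul_self,
        mul_one]
    rw [h4] at h3
    exact h3.mono (by omega)

/-- Such an element is determined by the map it induces on words of length `r`. -/
theorem finite_supportedOn_range (r : ℕ) :
    {g : G21 | SupportedOn g (Finset.range r)}.Finite := by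
  choose! F hF hF1 hF2 using fun (g : G21) (h : g ∈ {g : G21 | SupportedOn g (Finset.range r)}) =>
    (h : SupportedOn (g : M21) (Finset.range r))
  let ext : (Fin r → Bool) → ℕ → Bool := fun x i => if h : i < r then x ⟨i, h⟩ else false
  refine Set.Finite.of_finite_image (f := fun g (x : Fin r → Bool) (i : Fin r) => F g (ext x) i)
    (Set.toFinite _) fun g hg h hh e => ?_
  refine Units.ext (M21.ext_of_total fun s => ⟨0, F g s, hF g hg s, ?_⟩)
  have : F g s = F h s := by
    have hs : ∀ i ∈ Finset.range r, s i = ext (fun i : Fin r => s i) i := fun i hi => by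
      simp [ext, Finset.mem_range.1 hi]
    funext j
    by_cases hj : j ∈ Finset.range r
    · rw [hF2 g hg _ _ hs j hj, hF2 h hh _ _ hs j hj]
      exact congrFun (congrFun e fun i : Fin r => s i) ⟨j, Finset.mem_range.1 hj⟩
    · rw [hF1 g hg s j hj, hF1 h hh s j hj]
  rw [this]
  exact hF h hh s

theorem exists_cosetLen_bound (hτ : tauG ⊆ S) (hinv : ∀ s ∈ S, s⁻¹ ∈ S)
    (hgen : Subgroup.closure S = ⊤) {Γ : Set M21} (hΓ : Γ.Finite) (hΓL : Γ ⊆ lepM21) (n : ℕ) :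
    ∃ B, ∀ g ∈ lpG21, HasLen (Γ ∪ tauM) n (g : M21) → CosetLen S B g := by
  obtain ⟨c, hc⟩ := exists_supportedOn hΓ hΓL
  choose N hN using exists_cosetLen hinv hgen
  obtain ⟨B, hB⟩ := ((finite_supportedOn_range (n * c)).image N).bddAbove
  refine ⟨B + 2 * (n * c), fun g hg h => ?_⟩
  obtain ⟨A, hA, hsupp⟩ := hc n g hg h
  obtain ⟨g', h1, h2⟩ := exists_conj_supportedOn_range hτ (n * c) hsupp hA
    ((Finset.card_le_card Finset.sdiff_subset).trans hA)
  exact h2 B ((hN g').mono (hB ⟨g', h1, rfl⟩))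

/-! ## Comparison of the distortion functions -/

theorem distortion_le_distortion {T T' : Set M21} {m n : ℕ}
    (h : ∀ g ∈ lpG21, HasLen T n (g : M21) → HasLen T' m (g : M21)) :
    distortion S T n ≤ distortion S T' m := by
  refine iSup₂_le fun g hg => ?_
  exact le_iSup₂ (f := fun (g : G21) (_ : g ∈ lpG21 ∧ wordLength T' (g : M21) ≤ m) =>
    schreierDist S 1 g) g ⟨hg.1, wordLength_le_iff.2 (h g hg.1 (wordLength_le_iff.1 hg.2))⟩

theorem exists_hasLen_linear {Γ T : Set M21} (hΓ : Γ.Finite) (hτ : tauM ⊆ T)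
    (hgen : Γ ⊆ Submonoid.closure T) : ∃ c, 1 ≤ c ∧ ∀ n x, HasLen (Γ ∪ tauM) n x →
      HasLen T (c * n) x := by
  obtain ⟨c, hc⟩ := exists_hasLen_of_finite hΓ fun x hx => hgen hx
  refine ⟨c + 1, by omega, fun n x hx => ?_⟩
  rw [mul_comm]
  refine hx.trans ?_
  rintro s (hs | hs)
  · exact (hc s hs).mono (by omega)
  · exact (hasLen_of_mem (hτ hs)).mono (by omega)

end Thompson

theorem mainTheorem11
    (ΓG : Set Thompson.G21) (ΓL ΓM : Set Thompson.M21)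
    (hGfin : ΓG.Finite) (hGsymm : ∀ γ ∈ ΓG, γ⁻¹ ∈ ΓG)
    (hGgen : Subgroup.closure (ΓG ∪ Thompson.tauG) = ⊤)
    (hLfin : ΓL.Finite)
    (hLgen : (Submonoid.closure (ΓL ∪ Thompson.tauM) : Set Thompson.M21) = Thompson.lepM21)
    (hMfin : ΓM.Finite)
    (hMgen : Submonoid.closure (ΓM ∪ Thompson.tauM) = ⊤)
    (Δ δ : ℕ → ℕ∞)
    (hΔ : Δ = Thompson.distortion (ΓG ∪ Thompson.tauG) (ΓL ∪ Thompson.tauM))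
    (hδ : δ = Thompson.distortion (ΓG ∪ Thompson.tauG) (ΓM ∪ Thompson.tauM)) :
    (∀ n : ℕ, Δ n ≠ ⊤ ∧ δ n ≠ ⊤) ∧
    Thompson.PolyEquiv Δ δ ∧
    (∃ c₀ c' c₁ c₂ : ℕ, 1 ≤ c₀ ∧ 1 ≤ c' ∧ 1 ≤ c₁ ∧ 1 ≤ c₂ ∧ ∀ n : ℕ,
      Δ n ≤ c₁ * δ (c₀ * n) ∧ c₁ * δ (c₀ * n) ≤ c₂ * Δ (c' * n ^ 2)) ∧
    (ΓL ⊆ ΓM ∪ Thompson.tauM →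
      ∃ c' c₁ c₂ : ℕ, 1 ≤ c' ∧ 1 ≤ c₁ ∧ 1 ≤ c₂ ∧ ∀ n : ℕ,
        Δ n ≤ c₁ * δ n ∧ c₁ * δ n ≤ c₂ * Δ (c' * n ^ 2)) := by
  have hinv : ∀ s ∈ ΓG ∪ Thompson.tauG, s⁻¹ ∈ ΓG ∪ Thompson.tauG := by
    rintro s (hs | ⟨i, j, hij, hs⟩)
    · exact .inl (hGsymm s hs)
    · obtain rfl : s = Thompson.tauUnit i j hij := Units.ext hs
      -- A transposition is its own inverse by construction of `tauUnit`.
      exact .inr (Thompson.tauUnit_mem i j hij)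
  have hΓL : ΓL ⊆ Thompson.lepM21 := fun x hx =>
    hLgen ▸ Submonoid.subset_closure (Set.mem_union_left _ hx)
  obtain ⟨C, hC1, hC⟩ := Thompson.exists_hasLen_quadratic (S := ΓL ∪ Thompson.tauM)
    Set.subset_union_right hLgen.ge hMfin
  obtain ⟨c, hc1, hc⟩ := Thompson.exists_hasLen_linear (T := ΓM ∪ Thompson.tauM) hLfin
    Set.subset_union_right fun x _ => by rw [hMgen]; trivial
  have hΔδ : ∀ n, Δ n ≤ δ (c * n) := fun n => by
    rw [hΔ, hδ]
    exact Thompson.distortion_le_distortion fun g _ h => hc n _ h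
  have hδΔ : ∀ n, δ n ≤ Δ (C * n ^ 2) := fun n => by
    rw [hΔ, hδ]
    exact Thompson.distortion_le_distortion fun g hg h => hC n g hg h
  have hfin : ∀ n, Δ n ≠ ⊤ := fun n => by
    obtain ⟨B, hB⟩ := Thompson.exists_cosetLen_bound Set.subset_union_right hinv hGgen hLfin hΓL n
    have : Δ n ≤ B := by
      rw [hΔ]
      exact iSup₂_le fun g hg =>
        (hB g hg.1 (Thompson.wordLength_le_iff.1 hg.2)).schreierDist_le
    exact ne_top_of_le_ne_top (ENat.natCast_ne_top B) this
  have hmul : ∀ (a : ℕ) (x : ℕ∞), 1 ≤ a → x ≤ a * x := fun a x ha =>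
    le_mul_of_one_le_left zero_le (by exact_mod_cast ha)
  refine ⟨fun n => ⟨hfin n, ne_top_of_le_ne_top (hfin _) (hδΔ n)⟩, ?_, ?_, fun hsub => ?_⟩
  -- The exponents are 1 and 2. The outer square is harmless because `x ≤ x ^ 2` in `ℕ∞`, with 0
  -- treated apart.
  · refine ⟨1, c, C, 1, 2, one_pos, hc1, hC1, one_pos, two_pos, fun n _ => ⟨?_, ?_⟩⟩
    · rw [pow_one, pow_one]
      exact (hΔδ n).trans (hmul _ _ hc1)
    · refine (hδΔ n).trans (le_trans ?_ (hmul _ _ hC1))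
      rw [sq (Δ _)]
      rcases eq_or_ne (Δ (C * n ^ 2)) 0 with h | h
      · rw [h, zero_mul]
      · exact le_mul_of_one_le_left zero_le (Order.one_le_iff_ne_zero.2 h)
  -- The constant `C c ^ 2` comes from inserting `c n` into the quadratic bound.
  · refine ⟨c, C * c ^ 2, 1, 1, hc1, Nat.mul_pos hC1 (pow_pos hc1 2), le_rfl, le_rfl,
      fun n => ?_⟩
    rw [Nat.cast_one, one_mul, one_mul]
    refine ⟨hΔδ n, ?_⟩
    rw [mul_assoc, ← mul_pow]
    exact hδΔ _
  · refine ⟨C, 1, 1, hC1, le_rfl, le_rfl, fun n => ?_⟩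
    rw [Nat.cast_one, one_mul, one_mul]
    refine ⟨?_, hδΔ n⟩
    rw [hΔ, hδ]
    refine Thompson.distortion_le_distortion ?_
    rintro g _ ⟨w, hw, h⟩
    exact ⟨w, fun s hs => (hw s hs).elim (fun h => hsub h) .inr, h⟩
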